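/- Let $N$ be a smooth manifold of dimension $n\ge 3$, $g$ a smooth Riemannian metric on $N$, $\nabla$ a torsion-free connection on $TN$ and $\phi$ a smooth 1-form with $\nabla g=-2\phi\otimes g$ (so $(N,g,\nabla)$ is a Weyl manifold). For a connection $D$ put $\mathcal R^D(x,y)z=(D_xD_y-D_yD_x-D_{[x,y]})z$ and $\operatorname{Ric}^D(x,y)=\operatorname{Tr}\{z\mapsto \mathcal R^D(z,x)y\}$. For a Riemannian metric $h$ on $N$ let $\nabla^h$ be its Levi-Civita connection, let $\tau_h:=h^{ij}\operatorname{Ric}^{\nabla}_{ij}$ be the $h$-trace of the Ricci tensor of the given connection $\nabla$, let $\kappa_h:=\frac1{n(n-1)}h^{ij}\operatorname{Ric}^{\nabla^h}_{ij}$ be the normalized scalar curvature of $h$, let $\Delta_h f:=\Xi_h^{-1}\partial_{x_i}(\Xi_h h^{ij}\partial_{x_j}f)$ with $\Xi_h=\det(h_{ij})^{1/2}$, and let $\operatorname{grad}_h$ and $\|\cdot\|_h$ be the gradient and the pointwise norm of $h$. Assume that $\tau_g>0$ on all of $N$. Let $\tilde g:=\tau_g\, g$ (the canonical Weyl metric,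 which is again a smooth Riemannian metric) and $\tilde\phi:=\phi-\frac12\,d\ln\tau_g$, with $\tilde\phi^k:=\tilde g^{kl}\tilde\phi_l$. Then everywhere on $N$: 1. $n\kappa_{\tilde g}=n\tau_g^{-1}\kappa_g-\tau_g^{-2}\Delta_g\tau_g-\frac14\tau_g^{-3}(n-6)\,\|\operatorname{grad}_g\tau_g\|_g^2.$ 2. $1=\tau_{\tilde g}=n(n-1)\kappa_{\tilde g}-2(n-1)\nabla^{\tilde g}_k\tilde\phi^k-(n-1)(n-2)\|\tilde\phi\|_{\tilde g}^2.$ -/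

import Mathlib

open scoped Manifold ContDiff

noncomputable section

namespace WeylGeometry

open Bundle FiberBundle

/-- The model space `ℝⁿ`. -/
abbrev Model (n : ℕ) : Type := EuclideanSpace ℝ (Fin n)

/-- Vector fields (without any regularity) on an `n`-dimensional manifold `M` without boundary. -/
abbrev VField (n : ℕ) (M : Type*) [TopologicalSpace M] [ChartedSpace (Model n) M] : Type _ :=
  Π p : M, TangentSpace (𝓡 n) p

/-- 1-forms (without any regularity) on `M`. -/
abbrev OneForm (n : ℕ) (M : Type*) [TopologicalSpace M] [ChartedSpace (Model n) M] : Type _ :=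
  Π p : M, TangentSpace (𝓡 n) p →L[ℝ] ℝ

/-- A smooth Riemannian metric on `M`. -/
abbrev Metric (n : ℕ) (M : Type*) [TopologicalSpace M] [ChartedSpace (Model n) M]
    [IsManifold (𝓡 n) ∞ M] : Type _ :=
  ContMDiffRiemannianMetric (𝓡 n) ∞ (Model n) (fun p : M ↦ TangentSpace (𝓡 n) p)

variable {n : ℕ} {M : Type*} [TopologicalSpace M] [ChartedSpace (Model n) M]

/-- The basis `∂₁, …, ∂ₙ` of `T_p M` given by the preferred chart at `p`. -/
def tangentBasis (p : M) : Module.Basis (Fin n) ℝ (TangentSpace (𝓡 n) p) :=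
  (EuclideanSpace.basisFun (Fin n) ℝ).toBasis

/-- The differentials `dx¹, …, dxⁿ` of the coordinates of the preferred chart at `p`, at the
point `p`; this is the basis dual to `tangentBasis p`. -/
def coordForm (p : M) (i : Fin n) : TangentSpace (𝓡 n) p →L[ℝ] ℝ :=
  (EuclideanSpace.proj i : Model n →L[ℝ] ℝ)

theorem coordForm_apply (p : M) (i : Fin n) (v : TangentSpace (𝓡 n) p) :
    coordForm p i v = (tangentBasis p).coord i v := rfl

variable [IsManifold (𝓡 n) ∞ M]

/-- The coordinate vector fields `∂₁, …, ∂ₙ` of the preferred chart at `p`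
(extended by zero off the domain of that chart); see `coordField_eq` and `coordField_self`. -/
def coordField (p : M) (i : Fin n) : VField n M :=
  extend (Model n) (tangentBasis p i)

theorem coordField_self (p : M) (i : Fin n) : coordField p i p = tangentBasis p i := by
  simp [coordField]

theorem coordField_eq (p q : M) (i : Fin n) (hq : q ∈ (chartAt (Model n) p).source) :
    coordField p i q =
      mfderiv 𝓘(ℝ, Model n) (𝓡 n) (extChartAt (𝓡 n) p).symm (extChartAt (𝓡 n) p q)
        (EuclideanSpace.single i 1) := by
  have h2 := congrArg (fun L => L (EuclideanSpace.single i (1 : ℝ)))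
    (TangentBundle.symmL_trivializationAt (I := 𝓡 n) hq)
  simp only [ModelWithCorners.range_eq_univ, mfderivWithin_univ] at h2
  refine Eq.trans ?_ h2
  have h3 : (trivializationAt (Model n) (TangentSpace (𝓡 n) : M → Type) p
      ⟨p, tangentBasis p i⟩).2 = EuclideanSpace.single i (1 : ℝ) := by
    have h4 : (chartAt (Model n) p ∘ (chartAt (Model n) p).symm) =ᶠ[nhds (chartAt (Model n) p p)]
        id := (chartAt (Model n) p).eventually_right_inverse (mem_chart_target (Model n) p)
    have h5 := h4.fderiv_eq (𝕜 := ℝ)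
    rw [fderiv_id] at h5
    have h6 := congrArg (fun L => L (EuclideanSpace.single i (1 : ℝ))) h5
    simp only [TangentBundle.trivializationAt_apply, tangentBasis]
    simp
    refine Eq.trans ?_ h6
    exact congrArg _ (EuclideanSpace.basisFun_apply (Fin n) ℝ i)
  simp only [coordField, extend]
  rw [h3]
  refine (Trivialization.symmL_apply _ ?_ _).symm
  simpa using hq

/-! ### Metric notions -/

/-- The functions `g_{ij} = g(∂_i, ∂_j)` for the coordinate fields of the preferred chart at `p`. -/
def gram (g : Metric n M) (p q : M) : Matrix (Fin n) (Fin n) ℝ :=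
  Matrix.of fun i j ↦ g.inner q (coordField p i q) (coordField p j q)

/-- The vector field `φ♯` dual to the 1-form `φ`, i.e. `g(v, φ♯) = φ(v)`: its components are
`g^{ij} φ_j`. -/
def sharp (g : Metric n M) (φ : OneForm n M) (p : M) : TangentSpace (𝓡 n) p :=
  ∑ i, ∑ j, ((gram g p p)⁻¹ i j * φ p (tangentBasis p j)) • tangentBasis p i

/-- `‖φ‖_g² = g(φ♯, φ♯) = g^{ij} φ_i φ_j`. -/
def normSq (g : Metric n M) (φ : OneForm n M) (p : M) : ℝ :=
  g.inner p (sharp g φ p) (sharp g φ p)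

/-- The gradient of a function. -/
def grad (g : Metric n M) (f : M → ℝ) : VField n M :=
  sharp g (mvfderiv (𝓡 n) f)

/-- The Laplace-Beltrami operator `Δ_g f = Ξ⁻¹ ∂_i (Ξ g^{ij} ∂_j f)`, `Ξ = det (g_{ij})^{1/2}`,
computed at `p` in the preferred chart at `p`. -/
def laplacian (g : Metric n M) (f : M → ℝ) (p : M) : ℝ :=
  (√(gram g p p).det)⁻¹ * ∑ i, mvfderiv (𝓡 n)
    (fun q ↦ √(gram g p q).det *
      ∑ j, (gram g p q)⁻¹ i j * mvfderiv (𝓡 n) f q (coordField p j q)) p (tangentBasis p i)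

/-- The right-hand side of the Koszul formula for `g(∇^g_X Y, Z)`. -/
def koszul (g : Metric n M) (X Y Z : VField n M) (p : M) : ℝ :=
  (1 / 2) * (mvfderiv (𝓡 n) (fun q ↦ g.inner q (Y q) (Z q)) p (X p)
    + mvfderiv (𝓡 n) (fun q ↦ g.inner q (X q) (Z q)) p (Y p)
    - mvfderiv (𝓡 n) (fun q ↦ g.inner q (X q) (Y q)) p (Z p)
    + g.inner p (VectorField.mlieBracket (𝓡 n) X Y p) (Z p)
    - g.inner p (VectorField.mlieBracket (𝓡 n) X Z p) (Y p)
    - g.inner p (VectorField.mlieBracket (𝓡 n) Y Z p) (X p))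

/-- The Levi-Civita connection `∇^g` of `g`, defined by the Koszul formula; as for Mathlib's
covariant derivatives, `leviCivita g Y p v` is `(∇^g_v Y)(p)`. -/
def leviCivita (g : Metric n M) (Y : VField n M) (p : M) :
    TangentSpace (𝓡 n) p →L[ℝ] TangentSpace (𝓡 n) p :=
  ∑ i, (coordForm p i).smulRight
    (∑ k, ∑ l, ((gram g p p)⁻¹ k l * koszul g (coordField p i) Y (coordField p l) p) •
      tangentBasis p k)

/-- The divergence `∇^g_k X^k`. -/
def divergence (g : Metric n M) (X : VField n M) (p : M) : ℝ :=
  LinearMap.trace ℝ (TangentSpace (𝓡 n) p) (leviCivita g X p).toLinearMap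

/-! ### Curvature of a connection

In this section `∇ Y p v` stands for `(∇_v Y)(p)`. -/

/-- The curvature operator `R(X, Y)Z = ∇_X ∇_Y Z - ∇_Y ∇_X Z - ∇_{[X, Y]} Z`. -/
def curvature (nab : VField n M → Π p : M, TangentSpace (𝓡 n) p →L[ℝ] TangentSpace (𝓡 n) p)
    (X Y Z : VField n M) (p : M) : TangentSpace (𝓡 n) p :=
  nab (fun q ↦ nab Z q (Y q)) p (X p) - nab (fun q ↦ nab Z q (X q)) p (Y p)
    - nab Z p (VectorField.mlieBracket (𝓡 n) X Y p)

/-- The Ricci tensor `Ric(x, y) = Tr {z ↦ R(z, x) y}`, evaluated on `x = ∂_i`, `y = ∂_j` at `p`. -/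
def ricci (nab : VField n M → Π p : M, TangentSpace (𝓡 n) p →L[ℝ] TangentSpace (𝓡 n) p)
    (p : M) (i j : Fin n) : ℝ :=
  ∑ k, coordForm p k (curvature nab (coordField p k) (coordField p i) (coordField p j) p)

/-- The scalar curvature `Tr_g Ric = g^{ij} Ric(∂_i, ∂_j)` of the connection `∇` with respect
to `g`. -/
def scalarCurvature (g : Metric n M)
    (nab : VField n M → Π p : M, TangentSpace (𝓡 n) p →L[ℝ] TangentSpace (𝓡 n) p) (p : M) : ℝ :=
  ∑ i, ∑ j, (gram g p p)⁻¹ i j * ricci nab p i j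

/-- The normalized scalar curvature `κ_g = Tr_g Ric_g / (n (n - 1))` of a metric. -/
def kappa (g : Metric n M) (p : M) : ℝ :=
  1 / ((n : ℝ) * (n - 1)) * scalarCurvature g (leviCivita g) p

/-! ### Weyl manifolds -/

/-- Smoothness of a 1-form. -/
def IsSmoothOneForm (φ : OneForm n M) : Prop :=
  ContMDiff (𝓡 n) ((𝓡 n).prod 𝓘(ℝ, Model n →L[ℝ] ℝ)) ∞
    (fun p ↦ TotalSpace.mk' (Model n →L[ℝ] ℝ)
      (E := fun q : M ↦ TangentSpace (𝓡 n) q →L[ℝ] Trivial M ℝ q) p (φ p))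

/-- `(M, g, ∇)` is a Weyl manifold with associated 1-form `φ`: the connection `∇` is torsion free,
`φ` is smooth, and `∇g = -2 φ ⊗ g`. (Smoothness of `∇` is then automatic.) -/
structure IsWeyl (g : Metric n M)
    (nab : CovariantDerivative (𝓡 n) (Model n) (TangentSpace (𝓡 n) : M → Type))
    (φ : OneForm n M) : Prop where
  torsion_eq_zero : nab.torsion = 0
  smooth : IsSmoothOneForm φ
  nabla_metric : ∀ (p : M) (v : TangentSpace (𝓡 n) p) (Y Z : VField n M),
    MDifferentiableAt (𝓡 n) ((𝓡 n).prod 𝓘(ℝ, Model n))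
        (fun q ↦ TotalSpace.mk' (Model n) (E := fun q : M ↦ TangentSpace (𝓡 n) q) q (Y q)) p →
    MDifferentiableAt (𝓡 n) ((𝓡 n).prod 𝓘(ℝ, Model n))
        (fun q ↦ TotalSpace.mk' (Model n) (E := fun q : M ↦ TangentSpace (𝓡 n) q) q (Z q)) p →
      mvfderiv (𝓡 n) (fun q ↦ g.inner q (Y q) (Z q)) p v
        - g.inner p (nab Y p v) (Z p) - g.inner p (Y p) (nab Z p v) =
      -2 * φ p v * g.inner p (Y p) (Z p)

end WeylGeometry

end

/-!
The argument rests on one formula, `IsWeylConnection.scalarCurvature_eq`, valid for every Weyl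
connection `∇` (torsion free with `∇g = -2 φ ⊗ g`):
`tr_g Ric^∇ = tr_g Ric^g - 2 (n - 1) div_g φ♯ - (n - 1) (n - 2) ‖φ‖²_g`.
By a Koszul argument (`IsWeylConnection.eq_leviCivita_add`), `∇` differs from the Levi-Civita
connection of `g` by the tensor `A(x, y) = φ(x) y + φ(y) x - g(x, y) φ♯`. Hence the curvatures
differ by `(∇^g_x A)(y, z) - (∇^g_y A)(x, z) + A(x, A(y, z)) - A(y, A(x, z))`
(`IsWeylConnection.curvature_eq`), and contracting twice gives the formula.

The Weyl condition is conformally invariant: for the metric `s g` the connection `∇` has the 1-form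
`φ - (1/2) d ln s` (`IsWeylConnection.conformal`). The formula is applied twice.

* To the given connection and the metric `τ g`. Since `Ric^∇` does not depend on the metric, its
  trace is divided by `τ` when passing from `g` to `τ g`, and becomes `1`; this is the second claim.
* To the Levi-Civita connection of `τ g`, which is a Weyl connection for `g` with 1-form
  `(1/2) d ln τ`. This expresses the scalar curvature of `τ g` through that of `g` and the
  divergence of `(1/2) τ⁻¹ grad_g τ`, that is, through `Δ_g τ` and `‖grad_g τ‖²`, which is the first
  claim (`scalarCurvature_leviCivita_conformal`). The Laplacian, defined in coordinates, is the
  divergence of the gradient by Jacobi's formula for the derivative of a determinant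
  (`divergence_grad`).

For `τ g` to be a smooth metric, `τ` has to be smooth (`IsWeylConnection.smoothFun_scalarCurvature`).
All curvature quantities are defined at a point by means of the chart at that point, so this needs
that they are tensorial, that is, independent of the chart. Tensoriality of the curvature in its
last argument uses that the Lie bracket acts on functions as a commutator
(`mvfderiv_mlieBracket`), which is derived from the Jacobi identity.
-/

noncomputable section

namespace WeylGeometry

open scoped Topology
open Bundle FiberBundle

section

variable {n : ℕ} {M : Type*} [TopologicalSpace M] [ChartedSpace (Model n) M] [IsManifold (𝓡 n) ∞ M]

/-! ### Pointwise regularity and coordinate frames -/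

/-- Instance needed by Mathlib's Lie bracket of vector fields; made a local instance below. -/
lemma isManifold_minSmoothness_two : IsManifold (𝓡 n) (minSmoothness ℝ 2) M := by
  rw [minSmoothness_of_isRCLikeNormedField]; infer_instance

/-- Differentiability of a vector field at a point. -/
abbrev DiffField (X : VField n M) (p : M) : Prop :=
  MDifferentiableAt (𝓡 n) ((𝓡 n).prod 𝓘(ℝ, Model n))
    (fun q ↦ TotalSpace.mk' (Model n) (E := fun q : M ↦ TangentSpace (𝓡 n) q) q (X q)) p

/-- A vector field is of class `C^∞` at a point: for every finite `k` it is `C^k` on a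
neighbourhood, which may depend on `k`. -/
abbrev CInfField (X : VField n M) (p : M) : Prop :=
  ContMDiffAt (𝓡 n) ((𝓡 n).prod 𝓘(ℝ, Model n)) ∞
    (fun q ↦ TotalSpace.mk' (Model n) (E := fun q : M ↦ TangentSpace (𝓡 n) q) q (X q)) p

/-- Differentiability of a real function at a point. -/
abbrev DiffFun (n : ℕ) {M : Type*} [TopologicalSpace M] [ChartedSpace (Model n) M]
    (f : M → ℝ) (p : M) : Prop :=
  MDifferentiableAt (𝓡 n) 𝓘(ℝ, ℝ) f p

/-- A real function is of class `C^∞` at a point: for every finite `k` it is `C^k` on a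
neighbourhood, which may depend on `k`. -/
abbrev CInfFun (n : ℕ) {M : Type*} [TopologicalSpace M] [ChartedSpace (Model n) M]
    (f : M → ℝ) (p : M) : Prop :=
  ContMDiffAt (𝓡 n) 𝓘(ℝ, ℝ) ∞ f p

lemma DiffField.inner (g : Metric n M) {X Y : VField n M} {p : M} (hX : DiffField X p)
    (hY : DiffField Y p) : DiffFun n (fun q ↦ g.inner q (X q) (Y q)) p := by
  let _ : RiemannianBundle (fun p : M ↦ TangentSpace (𝓡 n) p) := ⟨g.toRiemannianMetric⟩
  have : IsContMDiffRiemannianBundle (𝓡 n) 1 (Model n) (fun p : M ↦ TangentSpace (𝓡 n) p) :=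
    IsContMDiffRiemannianBundle.of_le (n := ∞) (by simp)
  exact MDifferentiableAt.inner_bundle hX hY

lemma CInfField.inner (g : Metric n M) {X Y : VField n M} {p : M} (hX : CInfField X p)
    (hY : CInfField Y p) : CInfFun n (fun q ↦ g.inner q (X q) (Y q)) p := by
  let _ : RiemannianBundle (fun p : M ↦ TangentSpace (𝓡 n) p) := ⟨g.toRiemannianMetric⟩
  exact ContMDiffAt.inner_bundle hX hY

lemma CInfField.bracket {X Y : VField n M} {p : M} (hX : CInfField X p)
    (hY : CInfField Y p) : CInfField (VectorField.mlieBracket (𝓡 n) X Y) p := by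
  have : IsManifold (𝓡 n) (minSmoothness ℝ 2) M := isManifold_minSmoothness_two
  have : IsManifold (𝓡 n) (((⊤ : ℕ∞) : WithTop ℕ∞) + 1) M := by simpa
  refine ContMDiffAt.mlieBracket_vectorField (n := ⊤) (m := ⊤) hX hY (by simp)

lemma IsSmoothOneForm.apply {φ : OneForm n M} (hφ : IsSmoothOneForm φ) {X : VField n M} {p : M}
    (hX : CInfField X p) : CInfFun n (fun q ↦ φ q (X q)) p := by
  have := (hφ p).clm_bundle_apply (E₂ := Trivial M ℝ) hX
  simpa [contMDiffAt_section] using this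

lemma CInfFun.mvfderiv {f : M → ℝ} {X : VField n M} {p : M} (hf : CInfFun n f p)
    (hX : CInfField X p) : CInfFun n (fun q ↦ mvfderiv (𝓡 n) f q (X q)) p := by
  have h := ContMDiffAt.mfderiv_const (m := ∞) hf (by simp)
  have : ContMDiffAt (𝓡 n) (𝓘(ℝ,ℝ).prod 𝓘(ℝ,ℝ)) ∞ (fun m ↦ TotalSpace.mk' ℝ
      (E := fun x : ℝ ↦ TangentSpace 𝓘(ℝ, ℝ) x) (f m) (mfderiv (𝓡 n) 𝓘(ℝ, ℝ) f m (X m))) p :=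
    ContMDiffAt.clm_apply_of_inCoordinates (E₁ := fun p : M ↦ TangentSpace (𝓡 n) p)
      (E₂ := fun x : ℝ ↦ TangentSpace 𝓘(ℝ, ℝ) x) h hX hf
  rw [contMDiffAt_totalSpace] at this
  exact this.2.congr_of_eventuallyEq (.of_forall fun q => by simp [_root_.mvfderiv]; rfl)

lemma CInfField.diff {X : VField n M} {p : M} (hX : CInfField X p) : DiffField X p :=
  hX.mdifferentiableAt (by simp)

omit [IsManifold (𝓡 n) ∞ M] in
lemma CInfFun.diff {f : M → ℝ} {p : M} (hf : CInfFun n f p) : DiffFun n f p :=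
  hf.mdifferentiableAt (by simp)

lemma mem_baseSet_iff {p q : M} : q ∈ (trivializationAt (Model n) (TangentSpace (𝓡 n)) p).baseSet ↔
    q ∈ (chartAt (Model n) p).source := by simp

lemma coordField_eq_localFrame (p q : M) (i : Fin n) (hq : q ∈ (chartAt (Model n) p).source) :
    coordField p i q = (trivializationAt (Model n) (TangentSpace (𝓡 n)) p).localFrame
      (EuclideanSpace.basisFun (Fin n) ℝ).toBasis i q := by
  have h : (trivializationAt (Model n) (TangentSpace (𝓡 n) : M → Type) p
      ⟨p, tangentBasis p i⟩).2 = EuclideanSpace.single i (1 : ℝ) := by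
    have h4 : (chartAt (Model n) p ∘ (chartAt (Model n) p).symm) =ᶠ[𝓝 (chartAt (Model n) p p)]
        id := (chartAt (Model n) p).eventually_right_inverse (mem_chart_target (Model n) p)
    have h5 := h4.fderiv_eq (𝕜 := ℝ)
    rw [fderiv_id] at h5
    have h6 := congrArg (fun L => L (EuclideanSpace.single i (1 : ℝ))) h5
    simp only [TangentBundle.trivializationAt_apply, tangentBasis]
    simp
    exact (congrArg _ (EuclideanSpace.basisFun_apply (Fin n) ℝ i)).trans h6
  rw [Trivialization.localFrame_apply_of_mem_baseSet _ _ (mem_baseSet_iff.2 hq)]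
  simp only [coordField, extend]
  rw [h]
  simp [Trivialization.basisAt]

lemma isLocalFrameOn_coordField (p : M) :
    IsLocalFrameOn (𝓡 n) (Model n) ∞ (coordField (n := n) p) (chartAt (Model n) p).source := by
  have h := (trivializationAt (Model n) (TangentSpace (𝓡 n)) p).isLocalFrameOn_localFrame_baseSet
    (𝓡 n) ∞ (EuclideanSpace.basisFun (Fin n) ℝ).toBasis
  refine (h.mono (fun q hq => mem_baseSet_iff.2 hq)).congr fun i q hq => ?_
  exact (coordField_eq_localFrame p q i hq).symm

lemma cInfField_coordField {p q : M} (i : Fin n) (hq : q ∈ (chartAt (Model n) p).source) :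
    CInfField (coordField p i) q :=
  (isLocalFrameOn_coordField p).contMDiffAt (chartAt (Model n) p).open_source hq i

/-- The basis of `T_q M` given by the coordinate fields of the preferred chart at `p`. -/
def frameAt (p q : M) (hq : q ∈ (chartAt (Model n) p).source) :
    Module.Basis (Fin n) ℝ (TangentSpace (𝓡 n) q) :=
  (isLocalFrameOn_coordField p).toBasisAt hq

@[simp]
lemma frameAt_apply (p q : M) (hq : q ∈ (chartAt (Model n) p).source) (i : Fin n) :
    frameAt p q hq i = coordField p i q := by
  simp [frameAt]

/-! ### Linear algebra of an inner product and a basis -/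

/-- The Gram matrix of a basis of a tangent space. -/
def basisGram (g : Metric n M) {p : M} (b : Module.Basis (Fin n) ℝ (TangentSpace (𝓡 n) p)) :
    Matrix (Fin n) (Fin n) ℝ :=
  Matrix.of fun i j ↦ g.inner p (b i) (b j)

lemma gram_eq_basisGram (g : Metric n M) {p q : M} (hq : q ∈ (chartAt (Model n) p).source) :
    gram g p q = basisGram g (frameAt p q hq) := by
  ext i j; simp [gram, basisGram]

lemma gram_self_eq_basisGram (g : Metric n M) (p : M) :
    gram g p p = basisGram g (tangentBasis p) := by
  ext i j; simp [gram, basisGram, coordField_self]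

lemma sum_comm_pairs {ι : Type*} [Fintype ι] (f : ι → ι → ι → ι → ℝ) :
    ∑ i, ∑ j, ∑ k, ∑ l, f i j k l = ∑ k, ∑ l, ∑ i, ∑ j, f i j k l := by
  calc _ = ∑ i, ∑ k, ∑ j, ∑ l, f i j k l := Finset.sum_congr rfl fun _ _ => Finset.sum_comm
    _ = ∑ k, ∑ i, ∑ j, ∑ l, f i j k l := Finset.sum_comm
    _ = ∑ k, ∑ i, ∑ l, ∑ j, f i j k l :=
        Finset.sum_congr rfl fun _ _ => Finset.sum_congr rfl fun _ _ => Finset.sum_comm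
    _ = _ := Finset.sum_congr rfl fun _ _ => Finset.sum_comm

section LinearAlgebra

variable (g : Metric n M) {p : M} (b : Module.Basis (Fin n) ℝ (TangentSpace (𝓡 n) p))

lemma basisGram_posDef : (basisGram g b).PosDef := by
  refine Matrix.PosDef.of_dotProduct_mulVec_pos ?_ fun x hx => ?_
  · ext i j
    simp [basisGram, g.symm p (b i)]
  · have h : ∑ i, x i • b i ≠ 0 := fun h =>
      hx (funext (Fintype.linearIndependent_iff.1 b.linearIndependent x h))
    refine (g.pos p _ h).trans_eq ?_
    simp only [map_sum, map_smul, sum_apply, smul_apply,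
      dotProduct, Matrix.mulVec, basisGram, Matrix.of_apply, smul_eq_mul, Pi.star_apply,
      star_trivial, Finset.mul_sum]
    refine Finset.sum_congr rfl fun i _ => Finset.sum_congr rfl fun j _ => ?_
    rw [g.symm p (b i)]; ring

lemma isUnit_basisGram_det : IsUnit (basisGram g b).det :=
  (basisGram_posDef g b).det_pos.ne'.isUnit

lemma basisGram_inv_symm (i j : Fin n) : (basisGram g b)⁻¹ i j = (basisGram g b)⁻¹ j i := by
  have := (basisGram_posDef g b).1.inv.apply j i
  simpa using this

lemma repr_eq_sum_inv_basisGram (w : TangentSpace (𝓡 n) p) (i : Fin n) :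
    b.repr w i = ∑ j, (basisGram g b)⁻¹ i j * g.inner p (b j) w := by
  have h : (fun j => g.inner p (b j) w) = (basisGram g b).mulVec (b.repr w) := by
    ext j
    have e := congrArg (g.inner p (b j)) (b.sum_repr w)
    simp only [map_sum, map_smul, smul_eq_mul] at e
    rw [← e]
    simp [Matrix.mulVec, dotProduct, basisGram, mul_comm]
  have h2 : b.repr w i = ((basisGram g b)⁻¹.mulVec (fun j => g.inner p (b j) w)) i := by
    rw [h, Matrix.mulVec_mulVec, Matrix.nonsing_inv_mul _ (isUnit_basisGram_det g b),
      Matrix.one_mulVec]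
  exact h2

lemma sum_inv_basisGram_smul (w : TangentSpace (𝓡 n) p) :
    ∑ i, ∑ j, ((basisGram g b)⁻¹ i j * g.inner p (b j) w) • b i = w := by
  conv_rhs => rw [← b.sum_repr w]
  simp_rw [repr_eq_sum_inv_basisGram g b w, Finset.sum_smul]

/-- The vector `g^{ij} α(b_j) b_i` represents the linear form `α`. -/
lemma inner_sum_inv_basisGram (α : TangentSpace (𝓡 n) p → ℝ) (hα : IsLinearMap ℝ α)
    (w : TangentSpace (𝓡 n) p) :
    g.inner p (∑ i, ∑ j, ((basisGram g b)⁻¹ i j * α (b j)) • b i) w = α w := by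
  have h := congrArg (hα.mk' α) (sum_inv_basisGram_smul g b w)
  simp only [map_sum, map_smul, IsLinearMap.mk'_apply, smul_eq_mul] at h
  rw [← h, Finset.sum_comm]
  simp only [map_sum, map_smul, sum_apply, smul_apply,
    smul_eq_mul]
  refine Finset.sum_congr rfl fun i _ => Finset.sum_congr rfl fun j _ => ?_
  rw [basisGram_inv_symm]; ring

lemma metric_ext {u v : TangentSpace (𝓡 n) p} (h : ∀ w, g.inner p u w = g.inner p v w) :
    u = v := by
  by_contra hne
  have := g.pos p (u - v) (sub_ne_zero.2 hne)
  simp [h] at this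

/-- The contraction `g^{ij} B(b_i, b_j)` of a bilinear form. -/
def contraction (B : TangentSpace (𝓡 n) p → TangentSpace (𝓡 n) p → ℝ) : ℝ :=
  ∑ i, ∑ j, (basisGram g b)⁻¹ i j * B (b i) (b j)

/-- Contractions of bilinear forms do not depend on the basis. -/
lemma contraction_basis_indep (b' : Module.Basis (Fin n) ℝ (TangentSpace (𝓡 n) p))
    {B : TangentSpace (𝓡 n) p → TangentSpace (𝓡 n) p → ℝ}
    (h₁ : ∀ v, IsLinearMap ℝ fun u => B u v) (h₂ : ∀ u, IsLinearMap ℝ (B u)) :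
    contraction g b B = contraction g b' B := by
  have e₁ (i j) : B (b i) (b j) =
      ∑ k, ∑ l, (basisGram g b')⁻¹ k l * g.inner p (b' l) (b j) * B (b i) (b' k) := by
    have h := congrArg ((h₂ (b i)).mk' _) (sum_inv_basisGram_smul g b' (b j))
    simp only [map_sum, map_smul, IsLinearMap.mk'_apply, smul_eq_mul] at h
    exact h.symm
  have e₂ (k l) : B (b' l) (b' k) =
      ∑ i, ∑ j, (basisGram g b)⁻¹ i j * g.inner p (b j) (b' l) * B (b i) (b' k) := by
    have h := congrArg ((h₁ (b' k)).mk' _) (sum_inv_basisGram_smul g b (b' l))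
    simp only [map_sum, map_smul, IsLinearMap.mk'_apply, smul_eq_mul] at h
    exact h.symm
  calc contraction g b B
      = ∑ i, ∑ j, ∑ k, ∑ l, (basisGram g b)⁻¹ i j *
          ((basisGram g b')⁻¹ k l * g.inner p (b' l) (b j) * B (b i) (b' k)) := by
        simp only [contraction, e₁, Finset.mul_sum]
    _ = ∑ k, ∑ l, ∑ i, ∑ j, (basisGram g b)⁻¹ i j *
          ((basisGram g b')⁻¹ k l * g.inner p (b' l) (b j) * B (b i) (b' k)) := by
        exact sum_comm_pairs _
    _ = ∑ k, ∑ l, (basisGram g b')⁻¹ l k * B (b' l) (b' k) := by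
        refine Finset.sum_congr rfl fun k _ => Finset.sum_congr rfl fun l _ => ?_
        rw [e₂, Finset.mul_sum]
        refine Finset.sum_congr rfl fun i _ => ?_
        rw [Finset.mul_sum]
        refine Finset.sum_congr rfl fun j _ => ?_
        rw [basisGram_inv_symm g b' l k, g.symm p (b j)]; ring
    _ = contraction g b' B := Finset.sum_comm

/-- The trace of an endomorphism `A` is the contraction of `g(A ·, ·)`. -/
lemma sum_repr_eq_contraction (A : TangentSpace (𝓡 n) p → TangentSpace (𝓡 n) p) :
    ∑ k, b.repr (A (b k)) k = contraction g b fun u v => g.inner p (A u) v := by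
  refine Finset.sum_congr rfl fun i _ => ?_
  rw [repr_eq_sum_inv_basisGram g b]
  simp only [g.symm p (b _)]

lemma trace_eq_contraction (A : TangentSpace (𝓡 n) p →ₗ[ℝ] TangentSpace (𝓡 n) p) :
    LinearMap.trace ℝ _ A = contraction g b fun u v => g.inner p (A u) v := by
  rw [← sum_repr_eq_contraction, LinearMap.trace_eq_matrix_trace ℝ b, Matrix.trace]
  simp [LinearMap.toMatrix_apply]

lemma contraction_inner_right (α : TangentSpace (𝓡 n) p → ℝ) (hα : IsLinearMap ℝ α)
    (w : TangentSpace (𝓡 n) p) :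
    contraction g b (fun u v => α u * g.inner p w v) = α w := by
  rw [← inner_sum_inv_basisGram g b α hα w]
  simp only [map_sum, map_smul, sum_apply, smul_apply,
    smul_eq_mul, contraction]
  rw [Finset.sum_comm]
  refine Finset.sum_congr rfl fun i _ => Finset.sum_congr rfl fun j _ => ?_
  rw [basisGram_inv_symm, g.symm p w]; ring

lemma contraction_metric : contraction g b (fun u v => g.inner p u v) = n := by
  have := sum_repr_eq_contraction g b id
  simpa using this.symm

end LinearAlgebra

omit [IsManifold (𝓡 n) ∞ M] in
lemma coordForm_eq_repr (p : M) (k : Fin n) (v : TangentSpace (𝓡 n) p) :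
    coordForm p k v = (tangentBasis p).repr v k := rfl

lemma inner_sharp (g : Metric n M) (φ : OneForm n M) (p : M) (w : TangentSpace (𝓡 n) p) :
    g.inner p (sharp g φ p) w = φ p w := by
  rw [sharp, gram_self_eq_basisGram]
  exact inner_sum_inv_basisGram g (tangentBasis p) (φ p) (φ p).toLinearMap.isLinear w

end

attribute [local instance] isManifold_minSmoothness_two

section

variable {n : ℕ} {M : Type*} [TopologicalSpace M] [ChartedSpace (Model n) M]

/-! ### Smooth functions and vector fields near a point -/

section Functions

lemma CInfFun.det {A : M → Matrix (Fin n) (Fin n) ℝ} {p : M}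
    (hA : ∀ i j, CInfFun n (fun q ↦ A q i j) p) : CInfFun n (fun q ↦ (A q).det) p := by
  simp only [Matrix.det_apply]
  refine ContMDiffAt.sum fun σ _ => ?_
  have h : CInfFun n (fun q ↦ ∏ i, A q (σ i) i) p := ContMDiffAt.prod fun i _ => hA _ _
  simp only [Units.smul_def, zsmul_eq_mul]
  exact contMDiffAt_const.mul h

lemma CInfFun.inv {f : M → ℝ} {p : M} (hf : CInfFun n f p) (h0 : f p ≠ 0) :
    CInfFun n (fun q ↦ (f q)⁻¹) p :=
  ContMDiffAt.inv₀ hf h0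

lemma CInfFun.matrix_inv {A : M → Matrix (Fin n) (Fin n) ℝ} {p : M}
    (hA : ∀ i j, CInfFun n (fun q ↦ A q i j) p) (h0 : (A p).det ≠ 0) (i j : Fin n) :
    CInfFun n (fun q ↦ (A q)⁻¹ i j) p := by
  have h : CInfFun n (fun q ↦ (A q).adjugate i j) p := by
    simp only [Matrix.adjugate_apply]
    refine CInfFun.det fun k l => ?_
    by_cases hk : k = j
    · subst hk
      simpa using contMDiffAt_const
    · simpa [Matrix.updateRow_ne hk] using hA k l
  refine ((CInfFun.inv (CInfFun.det hA) h0).mul h).congr_of_eventuallyEq (.of_forall fun q => ?_)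
  simp [Matrix.inv_def]

end Functions

variable [IsManifold (𝓡 n) ∞ M]

lemma CInfField.add {X Y : VField n M} {p : M} (hX : CInfField X p) (hY : CInfField Y p) :
    CInfField (X + Y) p :=
  ContMDiffAt.add_section hX hY

lemma CInfField.smul {f : M → ℝ} {X : VField n M} {p : M} (hf : CInfFun n f p)
    (hX : CInfField X p) : CInfField (f • X) p :=
  ContMDiffAt.smul_section hf hX

lemma CInfField.sub {X Y : VField n M} {p : M} (hX : CInfField X p) (hY : CInfField Y p) :
    CInfField (X - Y) p :=
  ContMDiffAt.sub_section hX hY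

lemma DiffField.add {X Y : VField n M} {p : M} (hX : DiffField X p) (hY : DiffField Y p) :
    DiffField (X + Y) p :=
  mdifferentiableAt_add_section hX hY

lemma DiffField.smul {f : M → ℝ} {X : VField n M} {p : M} (hf : DiffFun n f p)
    (hX : DiffField X p) : DiffField (f • X) p :=
  MDifferentiableAt.smul_section hf hX

lemma CInfField.congr {X Y : VField n M} {p : M} (hX : CInfField X p)
    (h : ∀ᶠ q in 𝓝 p, Y q = X q) : CInfField Y p :=
  ContMDiffAt.congr_of_eventuallyEq hX (h.mono fun q hq => by simp [hq])

omit [IsManifold (𝓡 n) ∞ M] in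
lemma eventually_mem_source (p : M) : ∀ᶠ q in 𝓝 p, q ∈ (chartAt (Model n) p).source :=
  (chartAt (Model n) p).open_source.mem_nhds (mem_chart_source _ p)

lemma CInfFun.gram (g : Metric n M) {p q : M} (hq : q ∈ (chartAt (Model n) p).source)
    (i j : Fin n) : CInfFun n (fun q' ↦ gram g p q' i j) q :=
  (cInfField_coordField i hq).inner g (cInfField_coordField j hq)

lemma gram_posDef (g : Metric n M) {p q : M} (hq : q ∈ (chartAt (Model n) p).source) :
    (gram g p q).PosDef := by
  rw [gram_eq_basisGram g hq]; exact basisGram_posDef g _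

lemma CInfFun.gram_inv (g : Metric n M) {p q : M} (hq : q ∈ (chartAt (Model n) p).source)
    (i j : Fin n) : CInfFun n (fun q' ↦ (WeylGeometry.gram g p q')⁻¹ i j) q :=
  CInfFun.matrix_inv (fun _ _ => CInfFun.gram g hq _ _) (gram_posDef g hq).det_pos.ne' i j

lemma eq_sum_gram_inv (g : Metric n M) {p q : M} (hq : q ∈ (chartAt (Model n) p).source)
    (w : TangentSpace (𝓡 n) q) :
    w = ∑ i, ∑ j, ((gram g p q)⁻¹ i j * g.inner q (coordField p j q) w) • coordField p i q := by
  have := sum_inv_basisGram_smul g (frameAt p q hq) w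
  simp only [frameAt_apply, ← gram_eq_basisGram] at this
  exact this.symm

lemma CInfField.sum {ι : Type*} {s : Finset ι} {X : ι → VField n M} {p : M}
    (h : ∀ i ∈ s, CInfField (X i) p) : CInfField (fun q ↦ ∑ i ∈ s, X i q) p :=
  ContMDiffAt.sum_section h

/-- A vector field is smooth as soon as its inner products with the coordinate fields are. -/
lemma CInfField.of_inner (g : Metric n M) {X : VField n M} {p q : M}
    (hq : q ∈ (chartAt (Model n) p).source)
    (h : ∀ i, CInfFun n (fun q' ↦ g.inner q' (X q') (coordField p i q')) q) : CInfField X q := by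
  have h1 : CInfField (fun q' ↦ ∑ i, ((fun q' ↦ ∑ j, (WeylGeometry.gram g p q')⁻¹ i j *
      g.inner q' (X q') (coordField p j q')) • coordField p i) q') q := by
    refine CInfField.sum fun i _ => CInfField.smul ?_ (cInfField_coordField i hq)
    exact ContMDiffAt.sum fun j _ => (CInfFun.gram_inv g hq i j).mul (h j)
  refine h1.congr ?_
  filter_upwards [(chartAt (Model n) p).open_source.mem_nhds hq] with q' hq'
  conv_lhs => rw [eq_sum_gram_inv g hq' (X q')]
  refine Finset.sum_congr rfl fun i _ => ?_
  simp only [Pi.smul_apply', Finset.sum_smul, g.symm q' (X q')]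

/-- A vector field is smooth on a neighbourhood of `p`. Unlike `CInfField`, this gives a single
neighbourhood for all orders of differentiability. -/
def SmoothField (X : VField n M) (p : M) : Prop := ∀ᶠ q in 𝓝 p, CInfField X q

/-- A function is smooth on a neighbourhood of `p`. -/
def SmoothFun (n : ℕ) {M : Type*} [TopologicalSpace M] [ChartedSpace (Model n) M]
    (f : M → ℝ) (p : M) : Prop := ∀ᶠ q in 𝓝 p, CInfFun n f q

lemma SmoothField.at {X : VField n M} {p : M} (h : SmoothField X p) : CInfField X p :=
  h.self_of_nhds

omit [IsManifold (𝓡 n) ∞ M] in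
lemma SmoothFun.at {f : M → ℝ} {p : M} (h : SmoothFun n f p) : CInfFun n f p :=
  h.self_of_nhds

lemma SmoothField.diff {X : VField n M} {p : M} (h : SmoothField X p) : DiffField X p := h.at.diff

omit [IsManifold (𝓡 n) ∞ M] in
lemma SmoothFun.diff {f : M → ℝ} {p : M} (h : SmoothFun n f p) : DiffFun n f p := h.at.diff

lemma SmoothField.add {X Y : VField n M} {p : M} (hX : SmoothField X p) (hY : SmoothField Y p) :
    SmoothField (X + Y) p := by
  filter_upwards [hX, hY] with q h1 h2 using h1.add h2

lemma SmoothField.sub {X Y : VField n M} {p : M} (hX : SmoothField X p) (hY : SmoothField Y p) :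
    SmoothField (X - Y) p := by
  filter_upwards [hX, hY] with q h1 h2 using h1.sub h2

lemma SmoothField.smul {f : M → ℝ} {X : VField n M} {p : M} (hf : SmoothFun n f p)
    (hX : SmoothField X p) : SmoothField (f • X) p := by
  filter_upwards [hf, hX] with q h1 h2 using h2.smul h1

lemma SmoothField.congr {X Y : VField n M} {p : M} (hX : SmoothField X p)
    (h : ∀ᶠ q in 𝓝 p, Y q = X q) : SmoothField Y p := by
  filter_upwards [hX, eventually_eventually_nhds.2 h] with q h1 h2 using h1.congr h2

lemma SmoothField.inner (g : Metric n M) {X Y : VField n M} {p : M} (hX : SmoothField X p)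
    (hY : SmoothField Y p) : SmoothFun n (fun q ↦ g.inner q (X q) (Y q)) p := by
  filter_upwards [hX, hY] with q h1 h2 using h1.inner g h2

lemma SmoothField.bracket {X Y : VField n M} {p : M} (hX : SmoothField X p)
    (hY : SmoothField Y p) : SmoothField (VectorField.mlieBracket (𝓡 n) X Y) p := by
  filter_upwards [hX, hY] with q h1 h2 using h1.bracket h2

lemma SmoothFun.mvfderiv {f : M → ℝ} {X : VField n M} {p : M} (hf : SmoothFun n f p)
    (hX : SmoothField X p) : SmoothFun n (fun q ↦ mvfderiv (𝓡 n) f q (X q)) p := by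
  filter_upwards [hX, hf] with q h1 h2 using h2.mvfderiv h1

lemma smoothField_coordField {p q : M} (i : Fin n) (hq : q ∈ (chartAt (Model n) p).source) :
    SmoothField (coordField p i) q := by
  filter_upwards [(chartAt (Model n) p).open_source.mem_nhds hq] with q' hq'
  exact cInfField_coordField i hq'

lemma smoothField_coordField_self (p : M) (i : Fin n) : SmoothField (coordField p i) p :=
  smoothField_coordField i (mem_chart_source _ p)

lemma SmoothField.sum {ι : Type*} {s : Finset ι} {X : ι → VField n M} {p : M}
    (h : ∀ i ∈ s, SmoothField (X i) p) : SmoothField (fun q ↦ ∑ i ∈ s, X i q) p := by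
  filter_upwards [(Filter.eventually_all_finset s).2 h] with q hq using CInfField.sum hq

lemma SmoothField.of_inner (g : Metric n M) {X : VField n M} {p : M}
    (h : ∀ Y, SmoothField Y p → SmoothFun n (fun q ↦ g.inner q (X q) (Y q)) p) :
    SmoothField X p := by
  have h' := fun i => h _ (smoothField_coordField_self (n := n) p i)
  filter_upwards [eventually_mem_source (n := n) p, Filter.eventually_all.2 h'] with q hq h1
  exact CInfField.of_inner g hq h1

/-- The coefficients of a smooth vector field in the coordinate frame at `p`. -/
lemma exists_smooth_coeff {X : VField n M} {p : M} (hX : SmoothField X p) :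
    ∃ c : Fin n → M → ℝ, (∀ i, SmoothFun n (c i) p) ∧
      (∀ᶠ q in 𝓝 p, X q = ∑ i, c i q • coordField p i q) ∧
      ∀ i, c i p = (tangentBasis p).repr (X p) i := by
  set e := trivializationAt (Model n) (TangentSpace (𝓡 n) : M → Type) p with he
  set b := (EuclideanSpace.basisFun (Fin n) ℝ).toBasis with hb
  have h2 : ∀ᶠ q in 𝓝 p, X q =
      ∑ i, LinearMap.piApply (e.localFrameCoeff (𝓡 n) b i) X q • coordField p i q := by
    filter_upwards [eventually_mem_source (n := n) p] with q hq
    refine (e.eq_sum_localFrameCoeff_smul (I := 𝓡 n) (b := b) (mem_baseSet_iff.2 hq)).trans ?_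
    exact Finset.sum_congr rfl fun i _ => by rw [coordField_eq_localFrame p q i hq]; rfl
  refine ⟨fun i => LinearMap.piApply (e.localFrameCoeff (𝓡 n) b i) X, fun i => ?_, h2, fun i => ?_⟩
  · filter_upwards [hX, eventually_mem_source (n := n) p] with q hq hq'
    exact contMDiffAt_localFrameCoeff b (mem_baseSet_iff.2 hq') hq i
  · have h3 := h2.self_of_nhds
    simp only [coordField_self] at h3
    conv_rhs => rw [h3, Module.Basis.repr_sum_self]

/-! ### Operations on smooth vector fields which are tensorial at a point -/

/-- An operation on vector fields is linear over the germs at `p` of smooth functions, when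
applied to vector fields which are smooth near `p`. -/
structure SmoothTensorialAt {A : Type*} [AddCommGroup A] [Module ℝ A] (Φ : VField n M → A)
    (p : M) : Prop where
  smul : ∀ {f : M → ℝ} {X : VField n M}, SmoothFun n f p → SmoothField X p →
    Φ (f • X) = f p • Φ X
  add : ∀ {X Y : VField n M}, SmoothField X p → SmoothField Y p → Φ (X + Y) = Φ X + Φ Y

section Tensorial

variable {A : Type*} [AddCommGroup A] [Module ℝ A] {Φ : VField n M → A} {p : M}

lemma SmoothTensorialAt.congr (h : SmoothTensorialAt Φ p) {X Y : VField n M}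
    (hX : SmoothField X p) (hY : SmoothField Y p) (hXY : ∀ᶠ q in 𝓝 p, X q = Y q) :
    Φ X = Φ Y := by
  classical
  -- the indicator function of the set on which `X = Y` is smooth near `p`
  let ψ (q : M) : ℝ := if X q = Y q then 1 else 0
  have hψp : ψ p = 1 := by simp [ψ, hXY.self_of_nhds]
  have hψ : SmoothFun n ψ p := by
    filter_upwards [eventually_eventually_nhds.2 hXY] with q hq
    exact (contMDiffAt_const (c := (1 : ℝ))).congr_of_eventuallyEq
      (hq.mono fun q' hq' => by simp [ψ, hq'])
  have heq : ψ • X = ψ • Y := by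
    ext1 q
    by_cases hq : X q = Y q <;> simp [ψ, hq]
  have h1 := h.smul hψ hX
  rw [heq, h.smul hψ hY] at h1
  simpa [hψp] using h1.symm

lemma SmoothTensorialAt.zero (h : SmoothTensorialAt Φ p) {X : VField n M}
    (hX : SmoothField X p) : Φ 0 = 0 := by
  have h1 := h.smul (f := 0) (X := X) (.of_forall fun _ => contMDiffAt_const) hX
  simpa using h1

lemma SmoothTensorialAt.sum (h : SmoothTensorialAt Φ p) {ι : Type*} (s : Finset ι)
    {X : ι → VField n M} (hX : ∀ i, SmoothField (X i) p) {Y : VField n M} (hY : SmoothField Y p) :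
    Φ (fun q ↦ ∑ i ∈ s, X i q) = ∑ i ∈ s, Φ (X i) := by
  classical
  induction s using Finset.induction_on with
  | empty =>
    simp only [Finset.sum_empty]
    exact h.zero hY
  | insert a s ha ih =>
    simp only [Finset.sum_insert ha, ← ih]
    exact h.add (hX a) (SmoothField.sum fun i _ => hX i)

/-- A tensorial operation depends only on the value of the vector field at the point. -/
lemma SmoothTensorialAt.eq_sum (h : SmoothTensorialAt Φ p) {X : VField n M}
    (hX : SmoothField X p) :
    Φ X = ∑ i, (tangentBasis p).repr (X p) i • Φ (coordField p i) := by
  obtain ⟨c, hc, hXc, hcp⟩ := exists_smooth_coeff hX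
  have hs := fun i => SmoothField.smul (hc i) (smoothField_coordField_self p i)
  rw [h.congr hX (SmoothField.sum (s := Finset.univ) fun i _ => hs i) hXc, h.sum _ hs hX]
  refine Finset.sum_congr rfl fun i _ => ?_
  rw [h.smul (hc i) (smoothField_coordField_self p i), hcp]

end Tensorial

end

section

variable {n : ℕ} {M : Type*} [TopologicalSpace M] [ChartedSpace (Model n) M]
variable [IsManifold (𝓡 n) ∞ M]

/-! ### The Levi-Civita connection -/

section Koszul

variable (g : Metric n M) {X X' Y Z : VField n M} {f : M → ℝ} {p : M}

lemma mvfderiv_inner_smul_left (hf : DiffFun n f p) (hX : DiffField X p) (hY : DiffField Y p)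
    (v : TangentSpace (𝓡 n) p) :
    mvfderiv (𝓡 n) (fun q ↦ g.inner q ((f • X) q) (Y q)) p v =
      f p * mvfderiv (𝓡 n) (fun q ↦ g.inner q (X q) (Y q)) p v
        + g.inner p (X p) (Y p) * mvfderiv (𝓡 n) f p v := by
  have h : (fun q ↦ g.inner q ((f • X) q) (Y q)) =
      fun q ↦ f q * g.inner q (X q) (Y q) := by ext q; simp
  rw [h, mvfderiv_fun_mul hf (hX.inner g hY)]
  simp

lemma mvfderiv_inner_add_left (hX : DiffField X p) (hX' : DiffField X' p) (hY : DiffField Y p)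
    (v : TangentSpace (𝓡 n) p) :
    mvfderiv (𝓡 n) (fun q ↦ g.inner q ((X + X') q) (Y q)) p v =
      mvfderiv (𝓡 n) (fun q ↦ g.inner q (X q) (Y q)) p v
        + mvfderiv (𝓡 n) (fun q ↦ g.inner q (X' q) (Y q)) p v := by
  have h : (fun q ↦ g.inner q ((X + X') q) (Y q)) =
      fun q ↦ g.inner q (X q) (Y q) + g.inner q (X' q) (Y q) := by ext q; simp
  rw [h, mvfderiv_fun_add (hX.inner g hY) (hX'.inner g hY)]
  simp

lemma inner_fun_comm : (fun q ↦ g.inner q (X q) (Y q)) = fun q ↦ g.inner q (Y q) (X q) :=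
  funext fun q => g.symm q _ _

lemma mvfderiv_inner_smul_right (hf : DiffFun n f p) (hX : DiffField X p) (hY : DiffField Y p)
    (v : TangentSpace (𝓡 n) p) :
    mvfderiv (𝓡 n) (fun q ↦ g.inner q (Y q) ((f • X) q)) p v =
      f p * mvfderiv (𝓡 n) (fun q ↦ g.inner q (Y q) (X q)) p v
        + g.inner p (Y p) (X p) * mvfderiv (𝓡 n) f p v := by
  rw [inner_fun_comm g, mvfderiv_inner_smul_left g hf hX hY, inner_fun_comm g, g.symm]

lemma mvfderiv_inner_add_right (hX : DiffField X p) (hX' : DiffField X' p) (hY : DiffField Y p)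
    (v : TangentSpace (𝓡 n) p) :
    mvfderiv (𝓡 n) (fun q ↦ g.inner q (Y q) ((X + X') q)) p v =
      mvfderiv (𝓡 n) (fun q ↦ g.inner q (Y q) (X q)) p v
        + mvfderiv (𝓡 n) (fun q ↦ g.inner q (Y q) (X' q)) p v := by
  rw [inner_fun_comm g, mvfderiv_inner_add_left g hX hX' hY, inner_fun_comm g (X := X),
    inner_fun_comm g (X := X')]

open VectorField

lemma koszul_tensorial_left (hY : DiffField Y p) (hZ : DiffField Z p) :
    TensorialAt (𝓡 n) (Model n) (fun X : VField n M ↦ koszul g X Y Z p) p where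
  smul {f X} hf hX := by
    simp only [koszul, mvfderiv_inner_smul_left g hf hX hZ, mvfderiv_inner_smul_left g hf hX hY]
    simp only [mlieBracket_smul_left hf hX, Pi.smul_apply', map_smul, map_add, add_apply, smul_apply,
      smul_eq_mul, map_neg, neg_apply, neg_smul]
    ring
  add {X X'} hX hX' := by
    simp only [koszul, mvfderiv_inner_add_left g hX hX' hZ, mvfderiv_inner_add_left g hX hX' hY]
    simp only [mlieBracket_add_left hX hX', Pi.add_apply, map_add, add_apply]
    ring

lemma koszul_tensorial_right (hX : DiffField X p) (hY : DiffField Y p) :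
    TensorialAt (𝓡 n) (Model n) (fun Z : VField n M ↦ koszul g X Y Z p) p where
  smul {f Z} hf hZ := by
    simp only [koszul, mvfderiv_inner_smul_right g hf hZ hX, mvfderiv_inner_smul_right g hf hZ hY]
    simp only [mlieBracket_smul_right hf hZ, Pi.smul_apply', map_smul, map_add, add_apply, smul_apply,
      smul_eq_mul]
    rw [g.symm p (Z p) (Y p), g.symm p (Z p) (X p)]
    ring
  add {Z Z'} hZ hZ' := by
    simp only [koszul, mvfderiv_inner_add_right g hZ hZ' hX, mvfderiv_inner_add_right g hZ hZ' hY]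
    simp only [mlieBracket_add_right hZ hZ', Pi.add_apply, map_add, add_apply]
    ring

/-- The defining property of the Levi-Civita connection, for arbitrary differentiable fields. -/
lemma inner_leviCivita (hX : DiffField X p) (hY : DiffField Y p) (hZ : DiffField Z p) :
    g.inner p (leviCivita g Y p (X p)) (Z p) = koszul g X Y Z p := by
  let K := TensorialAt.mkHom₂ (I := 𝓡 n) (fun X Z : VField n M ↦ koszul g X Y Z p) p
    (fun Z hZ ↦ koszul_tensorial_left g hY hZ) (fun X hX ↦ koszul_tensorial_right g hX hY)
  have hK {X Z : VField n M} (hX : DiffField X p) (hZ : DiffField Z p) :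
      koszul g X Y Z p = K (X p) (Z p) :=
    (TensorialAt.mkHom₂_apply (I := 𝓡 n) (Φ := fun X Z : VField n M ↦ koszul g X Y Z p)
      (fun Z hZ ↦ koszul_tensorial_left g hY hZ) (fun X hX ↦ koszul_tensorial_right g hX hY)
      hX hZ).symm
  have hc (i : Fin n) := (smoothField_coordField_self p i).diff
  let W (i : Fin n) : TangentSpace (𝓡 n) p := ∑ k, ∑ l, ((gram g p p)⁻¹ k l *
    koszul g (coordField p i) Y (coordField p l) p) • tangentBasis p k
  have h0 : leviCivita g Y p (X p) = ∑ i, (tangentBasis p).repr (X p) i • W i := by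
    simp only [leviCivita, sum_apply, ContinuousLinearMap.smulRight_apply, coordForm_eq_repr, W]
  have h1 (i : Fin n) : g.inner p (W i) (Z p) = K (tangentBasis p i) (Z p) := by
    simp only [W, hK (hc _) (hc _), coordField_self, gram_self_eq_basisGram]
    exact inner_sum_inv_basisGram g (tangentBasis p) _ (K _).toLinearMap.isLinear _
  rw [hK hX hZ, h0]
  clear_value W
  conv_rhs => rw [← (tangentBasis p).sum_repr (X p)]
  simp only [map_sum, map_smul, sum_apply, smul_apply, h1]

/-- A vector is determined by its inner products with the values of differentiable fields. -/
lemma metric_ext_field {u v : TangentSpace (𝓡 n) p}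
    (h : ∀ W : VField n M, DiffField W p → g.inner p u (W p) = g.inner p v (W p)) : u = v := by
  refine metric_ext g fun w => ?_
  have := h (extend (Model n) w) (mdifferentiableAt_extend ..)
  simpa using this

lemma leviCivita_isCovariantDerivativeOn :
    IsCovariantDerivativeOn (I := 𝓡 n) (Model n) (leviCivita g) Set.univ where
  add {Y Y' p} hY hY' _ := by
    ext1 v
    obtain ⟨X, hX, rfl⟩ : ∃ X : VField n M, DiffField X p ∧ X p = v :=
      ⟨extend (Model n) v, mdifferentiableAt_extend .., by simp⟩
    refine metric_ext_field g fun Z hZ => ?_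
    rw [add_apply, map_add, add_apply, inner_leviCivita g hX (DiffField.add hY hY') hZ,
      inner_leviCivita g hX hY hZ, inner_leviCivita g hX hY' hZ]
    simp only [koszul, mvfderiv_inner_add_left g hY hY' hZ, mvfderiv_inner_add_right g hY hY' hX]
    simp only [mlieBracket_add_left hY hY', mlieBracket_add_right hY hY', Pi.add_apply, map_add, add_apply]
    ring
  leibniz {Y f p} hY hf _ := by
    ext1 v
    obtain ⟨X, hX, rfl⟩ : ∃ X : VField n M, DiffField X p ∧ X p = v :=
      ⟨extend (Model n) v, mdifferentiableAt_extend .., by simp⟩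
    refine metric_ext_field g fun Z hZ => ?_
    rw [add_apply, map_add, add_apply, inner_leviCivita g hX (DiffField.smul hf hY) hZ,
      smul_apply, map_smul, smul_apply, inner_leviCivita g hX hY hZ]
    simp only [koszul, mvfderiv_inner_smul_left g hf hY hZ, mvfderiv_inner_smul_right g hf hY hX]
    simp only [mlieBracket_smul_left hf hY, mlieBracket_smul_right hf hY, Pi.smul_apply', map_smul, map_add,
      add_apply, smul_apply, smul_eq_mul, map_neg, neg_apply, neg_smul,
      ContinuousLinearMap.smulRight_apply]
    rw [g.symm p (Y p) (X p)]
    ring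

lemma leviCivita_torsion_free (hX : DiffField X p) (hY : DiffField Y p) :
    leviCivita g Y p (X p) - leviCivita g X p (Y p) = mlieBracket (𝓡 n) X Y p := by
  refine metric_ext_field g fun Z hZ => ?_
  rw [map_sub, sub_apply, inner_leviCivita g hX hY hZ, inner_leviCivita g hY hX hZ, koszul, koszul,
    mlieBracket_swap_apply (V := Y) (W := X), inner_fun_comm g (X := Y) (Y := X)]
  simp only [map_neg, neg_apply]
  ring

lemma leviCivita_metric (hY : DiffField Y p) (hZ : DiffField Z p) (v : TangentSpace (𝓡 n) p) :
    mvfderiv (𝓡 n) (fun q ↦ g.inner q (Y q) (Z q)) p v =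
      g.inner p (leviCivita g Y p v) (Z p) + g.inner p (Y p) (leviCivita g Z p v) := by
  obtain ⟨X, hX, rfl⟩ : ∃ X : VField n M, DiffField X p ∧ X p = v :=
    ⟨extend (Model n) v, mdifferentiableAt_extend .., by simp⟩
  rw [g.symm p (Y p), inner_leviCivita g hX hY hZ, inner_leviCivita g hX hZ hY, koszul, koszul,
    mlieBracket_swap_apply (V := Z) (W := Y), inner_fun_comm g (X := Z) (Y := Y)]
  simp only [map_neg, neg_apply]
  ring

/-- `∇^g_X Y` is smooth if `X` and `Y` are. -/
lemma SmoothField.leviCivita (hX : SmoothField X p) (hY : SmoothField Y p) :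
    SmoothField (fun q ↦ leviCivita g Y q (X q)) p := by
  refine SmoothField.of_inner g fun Z hZ => ?_
  have h : SmoothFun n (fun q ↦ koszul g X Y Z q) p := by
    filter_upwards [(hY.inner g hZ).mvfderiv hX, (hX.inner g hZ).mvfderiv hY,
      (hX.inner g hY).mvfderiv hZ, (hX.bracket hY).inner g hZ, (hX.bracket hZ).inner g hY,
      (hY.bracket hZ).inner g hX] with q h1 h2 h3 h4 h5 h6
    exact contMDiffAt_const.mul (((((h1.add h2).sub h3).add h4).sub h5).sub h6)
  filter_upwards [h, eventually_eventually_nhds.2 hX, eventually_eventually_nhds.2 hY,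
    eventually_eventually_nhds.2 hZ] with q h hX hY hZ
  refine h.congr_of_eventuallyEq ?_
  filter_upwards [hX, hY, hZ] with q hX hY hZ
  exact inner_leviCivita g hX.diff hY.diff hZ.diff

end Koszul

end

section

variable {n : ℕ} {M : Type*} [TopologicalSpace M] [ChartedSpace (Model n) M]

/-! ### Weyl connections -/

/-- Chain rule for a real function of a map to a normed space. -/
lemma mvfderiv_comp_normedSpace {E : Type*} [NormedAddCommGroup E] [NormedSpace ℝ E] {F : E → ℝ}
    {F' : E →L[ℝ] ℝ} {f : M → E} {p : M} (hF : HasFDerivAt F F' (f p))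
    (hf : MDifferentiableAt (𝓡 n) 𝓘(ℝ, E) f p) (v : TangentSpace (𝓡 n) p) :
    mvfderiv (𝓡 n) (fun q ↦ F (f q)) p v = F' (mvfderiv (𝓡 n) f p v) := by
  have h := mvfderiv_comp_apply (I := 𝓘(ℝ, E)) (I' := 𝓡 n) (g := F) (f := f) p
    hF.differentiableAt.mdifferentiableAt hf v
  refine h.trans ?_
  have h2 : mvfderiv 𝓘(ℝ, E) F (f p) = fderiv ℝ F (f p) := by
    ext1; simp [mvfderiv, mfderiv_eq_fderiv]; rfl
  rw [h2, hF.fderiv]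
  rfl

lemma mvfderiv_comp_real {F : ℝ → ℝ} {F' : ℝ} {f : M → ℝ} {p : M} (hF : HasDerivAt F F' (f p))
    (hf : DiffFun n f p) (v : TangentSpace (𝓡 n) p) :
    mvfderiv (𝓡 n) (fun q ↦ F (f q)) p v = F' * mvfderiv (𝓡 n) f p v := by
  rw [mvfderiv_comp_normedSpace hF.hasFDerivAt hf]
  exact mul_comm _ _

lemma SmoothFun.log {s : M → ℝ} {p : M} (hs : SmoothFun n s p) (h0 : ∀ q, 0 < s q) :
    SmoothFun n (fun q ↦ Real.log (s q)) p := by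
  filter_upwards [hs] with q hq
  exact (Real.contDiffAt_log.2 (h0 q).ne').contMDiffAt.comp q hq

variable [IsManifold (𝓡 n) ∞ M]

/-- `∇` is a torsion-free connection with `∇g = -2 φ ⊗ g`, the form `φ` being smooth in the sense
that it takes smooth vector fields to smooth functions. In contrast to `IsWeyl`, the connection is
not bundled, so that this applies to `leviCivita` as well. -/
structure IsWeylConnection (g : Metric n M)
    (nab : VField n M → Π p : M, TangentSpace (𝓡 n) p →L[ℝ] TangentSpace (𝓡 n) p)
    (φ : OneForm n M) : Prop where
  cov : IsCovariantDerivativeOn (I := 𝓡 n) (Model n) nab Set.univ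
  torsion : ∀ {X Y : VField n M} {p : M}, DiffField X p → DiffField Y p →
    nab Y p (X p) - nab X p (Y p) = VectorField.mlieBracket (𝓡 n) X Y p
  metric : ∀ {Y Z : VField n M} {p : M}, DiffField Y p → DiffField Z p →
    ∀ v : TangentSpace (𝓡 n) p, mvfderiv (𝓡 n) (fun q ↦ g.inner q (Y q) (Z q)) p v =
      g.inner p (nab Y p v) (Z p) + g.inner p (Y p) (nab Z p v)
        - 2 * φ p v * g.inner p (Y p) (Z p)
  smooth : ∀ {X : VField n M} {p : M}, SmoothField X p → SmoothFun n (fun q ↦ φ q (X q)) p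

lemma IsWeyl.isWeylConnection {g : Metric n M}
    {nab : CovariantDerivative (𝓡 n) (Model n) (TangentSpace (𝓡 n) : M → Type)} {φ : OneForm n M}
    (h : IsWeyl g nab φ) : IsWeylConnection g nab φ where
  cov := nab.isCovariantDerivativeOnUniv
  torsion hX hY := nab.torsion_eq_zero_iff.1 h.torsion_eq_zero hX hY
  metric {Y Z p} hY hZ v := by linear_combination h.nabla_metric p v Y Z hY hZ
  smooth hX := hX.mono fun _ hq => h.smooth.apply hq

lemma isWeylConnection_leviCivita (g : Metric n M) :
    IsWeylConnection g (leviCivita g) (fun _ ↦ 0) where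
  cov := leviCivita_isCovariantDerivativeOn g
  torsion := leviCivita_torsion_free g
  metric hY hZ v := by simp [leviCivita_metric g hY hZ v]
  smooth _ := .of_forall fun q => by simpa using contMDiffAt_const

/-- Conformal invariance: a Weyl connection for `g` with 1-form `φ` is one for `s g`, with 1-form
`φ - (1/2) d ln s`. -/
lemma IsWeylConnection.conformal {g g' : Metric n M}
    {nab : VField n M → Π p : M, TangentSpace (𝓡 n) p →L[ℝ] TangentSpace (𝓡 n) p}
    {φ φ' : OneForm n M} (h : IsWeylConnection g nab φ) {s : M → ℝ}
    (hs : ∀ p, SmoothFun n s p) (h0 : ∀ p, 0 < s p) (hg : ∀ p, g'.inner p = s p • g.inner p)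
    (hφ : ∀ p, φ' p = φ p - (1 / 2 : ℝ) • mvfderiv (𝓡 n) (fun q ↦ Real.log (s q)) p) :
    IsWeylConnection g' nab φ' where
  cov := h.cov
  torsion := h.torsion
  metric {Y Z p} hY hZ v := by
    have h1 : (fun q ↦ g'.inner q (Y q) (Z q)) = fun q ↦ s q * g.inner q (Y q) (Z q) := by
      ext q; simp [hg]
    have h2 : s p ≠ 0 := (h0 p).ne'
    rw [h1, mvfderiv_fun_mul (hs p).diff (hY.inner g hZ), hφ]
    simp only [hg, add_apply, smul_apply, smul_eq_mul, sub_apply, h.metric hY hZ,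
      mvfderiv_comp_real (Real.hasDerivAt_log h2) (hs p).diff]
    field_simp
    ring
  smooth {X p} hX := by
    filter_upwards [h.smooth hX, ((hs p).log h0).mvfderiv hX] with q h1 h2
    refine (h1.sub (contMDiffAt_const (c := (1 / 2 : ℝ)) |>.mul h2)).congr_of_eventuallyEq
      (.of_forall fun q' => ?_)
    simp [hφ]

section

variable {g : Metric n M}
  {nab : VField n M → Π p : M, TangentSpace (𝓡 n) p →L[ℝ] TangentSpace (𝓡 n) p}
  {φ : OneForm n M} {X Y Z : VField n M} {p : M}

/-- The tensor `A(x, y) = φ(x) y + φ(y) x - g(x, y) φ♯` by which a Weyl connection differs from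
the Levi-Civita connection. -/
def weylTensor (g : Metric n M) (φ : OneForm n M) (p : M) (x y : TangentSpace (𝓡 n) p) :
    TangentSpace (𝓡 n) p :=
  φ p x • y + φ p y • x - g.inner p x y • sharp g φ p

/-- A Weyl connection is determined by its metric and its 1-form: all inner products of `∇_v Y` are
given by a Koszul formula. -/
lemma IsWeylConnection.eq_leviCivita_add (h : IsWeylConnection g nab φ) (hY : DiffField Y p)
    (v : TangentSpace (𝓡 n) p) :
    nab Y p v = leviCivita g Y p v + weylTensor g φ p v (Y p) := by
  obtain ⟨X, hX, rfl⟩ : ∃ X : VField n M, DiffField X p ∧ X p = v :=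
    ⟨extend (Model n) v, mdifferentiableAt_extend .., by simp⟩
  refine metric_ext_field g fun Z hZ => ?_
  simp only [weylTensor, map_add, map_sub, map_smul, add_apply, sub_apply, smul_apply, smul_eq_mul,
    inner_sharp]
  rw [inner_leviCivita g hX hY hZ, koszul, h.metric hY hZ, h.metric hX hZ, h.metric hX hY,
    ← h.torsion hX hY, ← h.torsion hX hZ, ← h.torsion hY hZ]
  simp only [map_sub, sub_apply]
  rw [g.symm p (nab Z p (X p)), g.symm p (nab Z p (Y p)), g.symm p (nab X p (Z p)),
    g.symm p (nab Y p (Z p))]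
  ring

lemma IsWeylConnection.smoothField_sharp (h : IsWeylConnection g nab φ) (p : M) :
    SmoothField (sharp g φ) p :=
  SmoothField.of_inner g fun Y hY => by
    simpa only [inner_sharp] using h.smooth hY

lemma SmoothField.weylTensor (h : IsWeylConnection g nab φ) (hX : SmoothField X p)
    (hY : SmoothField Y p) : SmoothField (fun q ↦ weylTensor g φ q (X q) (Y q)) p :=
  ((SmoothField.smul (h.smooth hX) hY).add (SmoothField.smul (h.smooth hY) hX)).sub
    (SmoothField.smul (hX.inner g hY) (h.smoothField_sharp p))

lemma IsWeylConnection.eventually_eq (h : IsWeylConnection g nab φ) (hY : SmoothField Y p)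
    (X : VField n M) : ∀ᶠ q in 𝓝 p, nab Y q (X q) =
      leviCivita g Y q (X q) + weylTensor g φ q (X q) (Y q) := by
  filter_upwards [hY] with q hq
  exact h.eq_leviCivita_add hq.diff _

lemma SmoothField.weylConnection (h : IsWeylConnection g nab φ) (hX : SmoothField X p)
    (hY : SmoothField Y p) : SmoothField (fun q ↦ nab Y q (X q)) p :=
  ((SmoothField.leviCivita g hX hY).add (SmoothField.weylTensor h hX hY)).congr
    (h.eventually_eq hY X)

end

end

section

variable {n : ℕ} {M : Type*} [TopologicalSpace M] [ChartedSpace (Model n) M]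
variable [IsManifold (𝓡 n) ∞ M]

/-! ### Curvature and scalar curvature of a Weyl connection -/

section

variable {g : Metric n M}
  {nab : VField n M → Π p : M, TangentSpace (𝓡 n) p →L[ℝ] TangentSpace (𝓡 n) p}
  {φ : OneForm n M} {X Y Z : VField n M} {p : M}

/-- The difference of the curvature operators of a Weyl connection and of the Levi-Civita
connection, in terms of `P = ∇^g φ♯`. -/
def curvatureDiff (g : Metric n M) (φ : OneForm n M) (p : M) (x y z : TangentSpace (𝓡 n) p) :
    TangentSpace (𝓡 n) p :=
  let P := leviCivita g (sharp g φ) p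
  (g.inner p (P x) y - g.inner p (P y) x) • z + g.inner p (P x) z • y - g.inner p (P y) z • x
    - g.inner p y z • P x + g.inner p x z • P y
    + weylTensor g φ p x (weylTensor g φ p y z) - weylTensor g φ p y (weylTensor g φ p x z)

/-- The derivative of `φ(Y)`, where `φ` is written as `g(φ♯, ·)` to use that `∇^g` is metric. -/
lemma IsWeylConnection.mvfderiv_oneForm (h : IsWeylConnection g nab φ) (hY : SmoothField Y p)
    (v : TangentSpace (𝓡 n) p) : mvfderiv (𝓡 n) (fun q ↦ φ q (Y q)) p v =
      g.inner p (leviCivita g (sharp g φ) p v) (Y p) + φ p (leviCivita g Y p v) := by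
  simp only [← inner_sharp g φ]
  exact leviCivita_metric g (h.smoothField_sharp p).diff hY.diff v

/-- The second covariant derivative, with `∇ = ∇^g + A` substituted twice and the Leibniz rule of
`∇^g` applied to `A(Y, Z)`. -/
lemma IsWeylConnection.nab_nab (h : IsWeylConnection g nab φ) (hY : SmoothField Y p)
    (hZ : SmoothField Z p) (v : TangentSpace (𝓡 n) p) :
    nab (fun q ↦ nab Z q (Y q)) p v =
      leviCivita g (fun q ↦ leviCivita g Z q (Y q)) p v
      + (mvfderiv (𝓡 n) (fun q ↦ φ q (Y q)) p v • Z p + φ p (Y p) • leviCivita g Z p v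
        + mvfderiv (𝓡 n) (fun q ↦ φ q (Z q)) p v • Y p + φ p (Z p) • leviCivita g Y p v
        - mvfderiv (𝓡 n) (fun q ↦ g.inner q (Y q) (Z q)) p v • sharp g φ p
        - g.inner p (Y p) (Z p) • leviCivita g (sharp g φ) p v)
      + weylTensor g φ p v (leviCivita g Z p (Y p) + weylTensor g φ p (Y p) (Z p)) := by
  have hW := SmoothField.weylConnection h hY hZ
  have hL := isWeylConnection_leviCivita g
  have hD := SmoothField.leviCivita g hY hZ
  have hS := h.smoothField_sharp p
  have h1 : SmoothField ((fun q ↦ φ q (Y q)) • Z) p := .smul (h.smooth hY) hZ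
  have h2 : SmoothField ((fun q ↦ φ q (Z q)) • Y) p := .smul (h.smooth hZ) hY
  have hn : SmoothFun n (fun q ↦ -g.inner q (Y q) (Z q)) p := (hY.inner g hZ).mono fun q hq => hq.neg
  have h3 : SmoothField ((fun q ↦ -g.inner q (Y q) (Z q)) • sharp g φ) p := .smul hn hS
  have e1 : leviCivita g (fun q ↦ nab Z q (Y q)) p =
      leviCivita g ((fun q ↦ leviCivita g Z q (Y q)) + ((fun q ↦ φ q (Y q)) • Z
        + (fun q ↦ φ q (Z q)) • Y + (fun q ↦ -g.inner q (Y q) (Z q)) • sharp g φ)) p := by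
    refine hL.cov.congr_of_eventuallyEq hW.diff (hD.add ((h1.add h2).add h3)).diff
      Filter.univ_mem ?_
    filter_upwards [h.eventually_eq hZ Y] with q hq
    rw [hq]
    simp only [weylTensor, Pi.add_apply, Pi.smul_apply', neg_smul]
    abel
  rw [h.eq_leviCivita_add hW.diff, e1, hL.cov.add hD.diff ((h1.add h2).add h3).diff,
    hL.cov.add (h1.add h2).diff h3.diff, hL.cov.add h1.diff h2.diff,
    hL.cov.leibniz hZ.diff (h.smooth hY).diff, hL.cov.leibniz hY.diff (h.smooth hZ).diff,
    hL.cov.leibniz hS.diff hn.diff, h.eq_leviCivita_add hZ.diff]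
  simp only [add_apply, smul_apply, ContinuousLinearMap.smulRight_apply]
  have e2 : mvfderiv (𝓡 n) (fun q ↦ -g.inner q (Y q) (Z q)) p v =
      -mvfderiv (𝓡 n) (fun q ↦ g.inner q (Y q) (Z q)) p v := by
    rw [mvfderiv_fun_neg, neg_apply]
  rw [e2]
  module

/-- The curvature of a Weyl connection differs from that of the Levi-Civita connection by a
tensor. -/
lemma IsWeylConnection.curvature_eq (h : IsWeylConnection g nab φ) (hX : SmoothField X p)
    (hY : SmoothField Y p) (hZ : SmoothField Z p) :
    curvature nab X Y Z p = curvature (leviCivita g) X Y Z p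
      + curvatureDiff g φ p (X p) (Y p) (Z p) := by
  rw [curvature, h.nab_nab hY hZ, h.nab_nab hX hZ, h.eq_leviCivita_add hZ.diff,
    h.mvfderiv_oneForm hX, h.mvfderiv_oneForm hY, h.mvfderiv_oneForm hZ, h.mvfderiv_oneForm hZ,
    leviCivita_metric g hY.diff hZ.diff, leviCivita_metric g hX.diff hZ.diff, curvature,
    curvatureDiff, ← leviCivita_torsion_free g hX.diff hY.diff]
  rw [g.symm p (X p) (leviCivita g Z p (Y p)), g.symm p (Y p) (leviCivita g Z p (X p))]
  simp only [weylTensor, map_add, map_sub, map_smul, sub_apply, smul_eq_mul]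
  rw [g.symm p (X p) (leviCivita g Z p (Y p)), g.symm p (Y p) (leviCivita g Z p (X p)),
    g.symm p (Y p) (X p)]
  module

/-! ### Traces and the scalar curvature -/

section Trace

variable (b : Module.Basis (Fin n) ℝ (TangentSpace (𝓡 n) p))

omit [IsManifold (𝓡 n) ∞ M] in
lemma sum_repr_smul_const (α : TangentSpace (𝓡 n) p →L[ℝ] ℝ) (u : TangentSpace (𝓡 n) p) :
    ∑ k, α (b k) * b.repr u k = α u := by
  have e := congrArg α (b.sum_repr u)
  simp only [map_sum, map_smul, smul_eq_mul] at e
  rw [← e]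
  exact Finset.sum_congr rfl fun _ _ => mul_comm _ _

omit [IsManifold (𝓡 n) ∞ M] in
lemma sum_repr_self : ∑ k, b.repr (b k) k = n := by simp

omit [IsManifold (𝓡 n) ∞ M] in
lemma sum_repr_eq_trace (A : TangentSpace (𝓡 n) p →L[ℝ] TangentSpace (𝓡 n) p) :
    ∑ k, b.repr (A (b k)) k = LinearMap.trace ℝ _ A.toLinearMap := by
  rw [LinearMap.trace_eq_matrix_trace ℝ b, Matrix.trace]
  simp [LinearMap.toMatrix_apply]

/-- The contribution of `curvatureDiff` to the Ricci tensor. -/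
lemma sum_repr_curvatureDiff (g : Metric n M) (φ : OneForm n M) (y z : TangentSpace (𝓡 n) p) :
    ∑ k, b.repr (curvatureDiff g φ p (b k) y z) k =
      g.inner p (leviCivita g (sharp g φ) p z) y
      + (1 - n) * g.inner p (leviCivita g (sharp g φ) p y) z
      - g.inner p y z * divergence g (sharp g φ) p
      + (n - 2) * (φ p y * φ p z - g.inner p y z * normSq g φ p) := by
  set P := leviCivita g (sharp g φ) p with hP
  set S := sharp g φ p with hS
  have hS' (w : TangentSpace (𝓡 n) p) : g.inner p S w = φ p w := inner_sharp g φ p w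
  have hn : φ p S = normSq g φ p := by rw [normSq, ← hS, hS']
  have key (k : Fin n) : b.repr (curvatureDiff g φ p (b k) y z) k =
      ((g.inner p y).comp P) (b k) * b.repr z k - g.inner p (P y) (b k) * b.repr z k
      + ((g.inner p z).comp P) (b k) * b.repr y k
      + (2 * φ p y * φ p z - g.inner p y z * φ p S - φ p y * φ p z - g.inner p (P y) z) *
        b.repr (b k) k
      - g.inner p y z * b.repr (P (b k)) k + g.inner p z (b k) * b.repr (P y) k
      - φ p z * (φ p (b k) * b.repr y k) + φ p S * (g.inner p z (b k) * b.repr y k)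
      + g.inner p y z * (φ p (b k) * b.repr S k)
      - φ p y * (g.inner p z (b k) * b.repr S k) := by
    simp only [curvatureDiff, weylTensor, ← hP, ← hS, map_add, map_sub, map_smul, Finsupp.add_apply,
      Finsupp.sub_apply, Finsupp.smul_apply, smul_eq_mul, ContinuousLinearMap.comp_apply]
    rw [g.symm p (b k) z, g.symm p (b k) y, g.symm p (b k) S, g.symm p y S, hS', hS',
      g.symm p (P (b k)), g.symm p (P (b k))]
    ring
  simp only [key, Finset.sum_add_distrib, Finset.sum_sub_distrib, ← Finset.mul_sum,
    sum_repr_smul_const, sum_repr_self, sum_repr_eq_trace]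
  simp only [ContinuousLinearMap.comp_apply, ← hn, divergence, ← hP]
  rw [g.symm p z S, hS', g.symm p (P z), g.symm p (P y) z, g.symm p z y]
  ring

lemma contraction_swap (g : Metric n M)
    (B : TangentSpace (𝓡 n) p → TangentSpace (𝓡 n) p → ℝ) :
    contraction g b (fun u v => B v u) = contraction g b B := by
  simp only [contraction]
  rw [Finset.sum_comm]
  refine Finset.sum_congr rfl fun i _ => Finset.sum_congr rfl fun j _ => ?_
  rw [basisGram_inv_symm]

end Trace

lemma contraction_eq_normSq (g : Metric n M) (φ : OneForm n M)
    (b : Module.Basis (Fin n) ℝ (TangentSpace (𝓡 n) p)) :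
    contraction g b (fun u v => φ p u * φ p v) = normSq g φ p := by
  have h := contraction_inner_right g b (φ p) (φ p).toLinearMap.isLinear (sharp g φ p)
  simp only [inner_sharp] at h
  rw [h, normSq, inner_sharp]

/-- The scalar curvature of a Weyl connection: contraction of `curvature_eq` over the endomorphism
index (`sum_repr_curvatureDiff`) and then over the two remaining arguments. -/
theorem IsWeylConnection.scalarCurvature_eq (h : IsWeylConnection g nab φ) (p : M) :
    scalarCurvature g nab p = scalarCurvature g (leviCivita g) p
      - 2 * (n - 1) * divergence g (sharp g φ) p - (n - 1) * (n - 2) * normSq g φ p := by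
  have hc (i : Fin n) := smoothField_coordField_self (n := n) p i
  set b := tangentBasis (n := n) p with hb
  have hr (i j : Fin n) : ricci nab p i j = ricci (leviCivita g) p i j +
      (g.inner p (leviCivita g (sharp g φ) p (b j)) (b i)
      + (1 - n) * g.inner p (leviCivita g (sharp g φ) p (b i)) (b j)
      - g.inner p (b i) (b j) * divergence g (sharp g φ) p
      + (n - 2) * (φ p (b i) * φ p (b j) - g.inner p (b i) (b j) * normSq g φ p)) := by
    simp only [ricci, h.curvature_eq (hc _) (hc _) (hc _), coordForm_eq_repr, map_add,
      Finset.sum_add_distrib, coordField_self]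
    rw [sum_repr_curvatureDiff]
  have t1 := trace_eq_contraction g b (leviCivita g (sharp g φ) p).toLinearMap
  have t2 := contraction_swap b g fun u v => g.inner p (leviCivita g (sharp g φ) p u) v
  have t3 := contraction_metric g b
  have t4 := contraction_eq_normSq g φ b
  have hd : divergence g (sharp g φ) p =
      LinearMap.trace ℝ _ (leviCivita g (sharp g φ) p).toLinearMap := rfl
  simp only [ContinuousLinearMap.coe_coe] at t1
  rw [← hd] at t1
  rw [← t1] at t2
  simp only [contraction] at t1 t2 t3 t4
  have e (i j : Fin n) : (basisGram g b)⁻¹ i j * ricci nab p i j =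
      (basisGram g b)⁻¹ i j * ricci (leviCivita g) p i j
      + (basisGram g b)⁻¹ i j * g.inner p (leviCivita g (sharp g φ) p (b j)) (b i)
      + (1 - n) * ((basisGram g b)⁻¹ i j * g.inner p (leviCivita g (sharp g φ) p (b i)) (b j))
      - (divergence g (sharp g φ) p + (n - 2) * normSq g φ p) *
        ((basisGram g b)⁻¹ i j * g.inner p (b i) (b j))
      + (n - 2) * ((basisGram g b)⁻¹ i j * (φ p (b i) * φ p (b j))) := by
    rw [hr]; ring
  simp only [scalarCurvature, gram_self_eq_basisGram, ← hb, e, Finset.sum_add_distrib,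
    Finset.sum_sub_distrib, ← Finset.mul_sum, t2, t3, t4]
  rw [← t1]
  ring

end

end

section

variable {n : ℕ} {M : Type*} [TopologicalSpace M] [ChartedSpace (Model n) M]
variable [IsManifold (𝓡 n) ∞ M]

/-! ### Tensoriality of the curvature and smoothness of the scalar curvature -/

section

open VectorField

variable {g : Metric n M}
  {nab : VField n M → Π p : M, TangentSpace (𝓡 n) p →L[ℝ] TangentSpace (𝓡 n) p}
  {φ : OneForm n M} {X Y Z : VField n M} {p : M}

lemma SmoothField.contMDiffAt_minSmoothness (hX : SmoothField X p) :
    ContMDiffAt (𝓡 n) ((𝓡 n).prod 𝓘(ℝ, Model n)) (minSmoothness ℝ 2)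
      (fun q ↦ TotalSpace.mk' (Model n) (E := fun q : M ↦ TangentSpace (𝓡 n) q) q (X q)) p := by
  rw [minSmoothness_of_isRCLikeNormedField]
  exact hX.at.of_le (WithTop.coe_le_coe.2 (le_top : (2 : ℕ∞) ≤ ⊤))

/-- `[X, [Y, fZ]]`, expanded by the Leibniz rule. -/
lemma mlieBracket_mlieBracket_smul {f : M → ℝ} (X : VField n M) (hY : SmoothField Y p)
    (hZ : SmoothField Z p) (hf : SmoothFun n f p) :
    mlieBracket (𝓡 n) X (mlieBracket (𝓡 n) Y (f • Z)) p =
      mvfderiv (𝓡 n) (fun q ↦ mvfderiv (𝓡 n) f q (Y q)) p (X p) • Z p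
      + mvfderiv (𝓡 n) f p (Y p) • mlieBracket (𝓡 n) X Z p
      + mvfderiv (𝓡 n) f p (X p) • mlieBracket (𝓡 n) Y Z p
      + f p • mlieBracket (𝓡 n) X (mlieBracket (𝓡 n) Y Z) p := by
  have hfY := hf.mvfderiv hY
  have hYZ := hY.bracket hZ
  have h1 : mlieBracket (𝓡 n) Y (f • Z) =ᶠ[𝓝 p]
      (fun q ↦ mvfderiv (𝓡 n) f q (Y q)) • Z + f • mlieBracket (𝓡 n) Y Z := by
    filter_upwards [hf, hZ] with q h1 h2
    rw [mlieBracket_smul_right h1.diff h2.diff]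
    rfl
  rw [Filter.EventuallyEq.mlieBracket_vectorField_eq (Filter.EventuallyEq.refl _ X) h1,
    mlieBracket_add_right (SmoothField.smul hfY hZ).diff (SmoothField.smul hf hYZ).diff,
    mlieBracket_smul_right hfY.diff hZ.diff, mlieBracket_smul_right hf.diff hYZ.diff]
  module

/-- The Lie bracket is the commutator of the derivations. This follows from the Jacobi identity for
`X`, `Y` and `f Z`, where `Z` does not vanish at the point. -/
lemma mvfderiv_mlieBracket {f : M → ℝ} (hX : SmoothField X p) (hY : SmoothField Y p)
    (hf : SmoothFun n f p) :
    mvfderiv (𝓡 n) f p (mlieBracket (𝓡 n) X Y p) =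
      mvfderiv (𝓡 n) (fun q ↦ mvfderiv (𝓡 n) f q (Y q)) p (X p)
      - mvfderiv (𝓡 n) (fun q ↦ mvfderiv (𝓡 n) f q (X q)) p (Y p) := by
  rcases isEmpty_or_nonempty (Fin n) with hn | ⟨⟨i⟩⟩
  · have h0 (v : TangentSpace (𝓡 n) p) : v = 0 := by
      rw [← (tangentBasis p).sum_repr v]; simp
    rw [h0 (X p), h0 (Y p), h0 (mlieBracket (𝓡 n) X Y p)]; simp
  · have : IsManifold (𝓡 n) (minSmoothness ℝ 3) M := by
      rw [minSmoothness_of_isRCLikeNormedField]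
      exact IsManifold.of_le (n := ∞) (WithTop.coe_le_coe.2 (le_top : (3 : ℕ∞) ≤ ⊤))
    have hZ := smoothField_coordField_self p i
    have hfZ := SmoothField.smul hf hZ
    have j1 := leibniz_identity_mlieBracket_apply hX.contMDiffAt_minSmoothness
      hY.contMDiffAt_minSmoothness hfZ.contMDiffAt_minSmoothness
    have j2 := leibniz_identity_mlieBracket_apply hX.contMDiffAt_minSmoothness
      hY.contMDiffAt_minSmoothness hZ.contMDiffAt_minSmoothness
    rw [mlieBracket_mlieBracket_smul X hY hZ hf, mlieBracket_mlieBracket_smul Y hX hZ hf, j2,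
      mlieBracket_smul_right hf.diff hZ.diff, coordField_self] at j1
    have h0 : (mvfderiv (𝓡 n) f p (mlieBracket (𝓡 n) X Y p)
        - (mvfderiv (𝓡 n) (fun q ↦ mvfderiv (𝓡 n) f q (Y q)) p (X p)
        - mvfderiv (𝓡 n) (fun q ↦ mvfderiv (𝓡 n) f q (X q)) p (Y p))) • tangentBasis p i = 0 := by
      rw [← sub_eq_zero] at j1
      rw [← neg_eq_zero, ← j1]
      module
    exact sub_eq_zero.1 ((smul_eq_zero.1 h0).resolve_right ((tangentBasis p).ne_zero i))

omit [IsManifold (𝓡 n) ∞ M] in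
lemma curvature_swap (X Y Z : VField n M) (p : M) :
    curvature nab X Y Z p = -curvature nab Y X Z p := by
  simp only [curvature]
  rw [mlieBracket_swap_apply (V := X)]
  simp only [map_neg]
  abel

lemma IsWeylConnection.curvature_tensorial_left (h : IsWeylConnection g nab φ)
    (Y : VField n M) (hZ : SmoothField Z p) :
    SmoothTensorialAt (fun X : VField n M ↦ curvature nab X Y Z p) p where
  smul {f X} hf hX := by
    have e : (fun q ↦ nab Z q ((f • X) q)) = f • fun q ↦ nab Z q (X q) := by ext1 q; simp
    simp only [curvature]
    rw [e, h.cov.leibniz (SmoothField.weylConnection h hX hZ).diff hf.diff,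
      mlieBracket_smul_left hf.diff hX.diff]
    simp only [Pi.smul_apply', map_add, map_smul, add_apply, smul_apply,
      ContinuousLinearMap.smulRight_apply, map_neg, neg_smul]
    module
  add {X X'} hX hX' := by
    have e : (fun q ↦ nab Z q ((X + X') q)) = (fun q ↦ nab Z q (X q)) + fun q ↦ nab Z q (X' q) := by
      ext1 q; simp
    simp only [curvature]
    rw [e, h.cov.add (SmoothField.weylConnection h hX hZ).diff
      (SmoothField.weylConnection h hX' hZ).diff, mlieBracket_add_left hX.diff hX'.diff]
    simp only [Pi.add_apply, map_add, add_apply]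
    abel

lemma IsWeylConnection.curvature_tensorial_middle (h : IsWeylConnection g nab φ)
    (X : VField n M) (hZ : SmoothField Z p) :
    SmoothTensorialAt (fun Y : VField n M ↦ curvature nab X Y Z p) p where
  smul hf hY := by
    rw [curvature_swap, (h.curvature_tensorial_left X hZ).smul hf hY, curvature_swap X, smul_neg]
  add hY hY' := by
    rw [curvature_swap, (h.curvature_tensorial_left X hZ).add hY hY', curvature_swap X,
      curvature_swap X, neg_add]

lemma IsWeylConnection.nab_nab_smul (h : IsWeylConnection g nab φ) (hY : SmoothField Y p)
    (hZ : SmoothField Z p) {f : M → ℝ} (hf : SmoothFun n f p) (v : TangentSpace (𝓡 n) p) :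
    nab (fun q ↦ nab (f • Z) q (Y q)) p v = f p • nab (fun q ↦ nab Z q (Y q)) p v
      + mvfderiv (𝓡 n) f p v • nab Z p (Y p) + mvfderiv (𝓡 n) f p (Y p) • nab Z p v
      + mvfderiv (𝓡 n) (fun q ↦ mvfderiv (𝓡 n) f q (Y q)) p v • Z p := by
  have hN := SmoothField.weylConnection h hY hZ
  have h1 := SmoothField.smul hf hN
  have h2 := SmoothField.smul (hf.mvfderiv hY) hZ
  have e : nab (fun q ↦ nab (f • Z) q (Y q)) p = nab ((f • fun q ↦ nab Z q (Y q)) +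
      (fun q ↦ mvfderiv (𝓡 n) f q (Y q)) • Z) p := by
    refine h.cov.congr_of_eventuallyEq
      (SmoothField.weylConnection h hY (SmoothField.smul hf hZ)).diff (h1.add h2).diff
      Filter.univ_mem ?_
    filter_upwards [hf, hZ] with q hf hZ
    rw [h.cov.leibniz hZ.diff hf.diff]
    simp
  rw [e, h.cov.add h1.diff h2.diff, h.cov.leibniz hN.diff hf.diff,
    h.cov.leibniz hZ.diff (hf.mvfderiv hY).diff]
  simp only [add_apply, smul_apply, ContinuousLinearMap.smulRight_apply]
  module

/-- Tensoriality in the third argument; the second derivatives of `f` cancel by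
`mvfderiv_mlieBracket`. -/
lemma IsWeylConnection.curvature_tensorial_right (h : IsWeylConnection g nab φ)
    (hX : SmoothField X p) (hY : SmoothField Y p) :
    SmoothTensorialAt (fun Z : VField n M ↦ curvature nab X Y Z p) p where
  smul {f Z} hf hZ := by
    simp only [curvature]
    rw [h.nab_nab_smul hY hZ hf, h.nab_nab_smul hX hZ hf, h.cov.leibniz hZ.diff hf.diff]
    simp only [add_apply, smul_apply, ContinuousLinearMap.smulRight_apply]
    rw [mvfderiv_mlieBracket hX hY hf]
    module
  add {Z Z'} hZ hZ' := by
    have e {X Y : VField n M} (hY : SmoothField Y p) :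
        nab (fun q ↦ nab (Z + Z') q (Y q)) p (X p) =
        nab (fun q ↦ nab Z q (Y q)) p (X p) + nab (fun q ↦ nab Z' q (Y q)) p (X p) := by
      have h1 := SmoothField.weylConnection h hY hZ
      have h2 := SmoothField.weylConnection h hY hZ'
      have e : nab (fun q ↦ nab (Z + Z') q (Y q)) p =
          nab ((fun q ↦ nab Z q (Y q)) + fun q ↦ nab Z' q (Y q)) p := by
        refine h.cov.congr_of_eventuallyEq (SmoothField.weylConnection h hY (hZ.add hZ')).diff
          (h1.add h2).diff Filter.univ_mem ?_
        filter_upwards [hZ, hZ'] with q hZ hZ'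
        rw [h.cov.add hZ.diff hZ'.diff]
        simp
      rw [e, h.cov.add h1.diff h2.diff, add_apply]
    simp only [curvature]
    rw [e hY, e hX, h.cov.add hZ.diff hZ'.diff]
    simp only [add_apply]
    abel

/-- The curvature tensor at `p`, obtained by multilinear extension from the coordinate fields. -/
def curvatureTensor (nab : VField n M → Π p : M, TangentSpace (𝓡 n) p →L[ℝ] TangentSpace (𝓡 n) p)
    (p : M) (x y z : TangentSpace (𝓡 n) p) : TangentSpace (𝓡 n) p :=
  ∑ i, (tangentBasis p).repr x i • ∑ j, (tangentBasis p).repr y j •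
    ∑ k, (tangentBasis p).repr z k •
      curvature nab (coordField p i) (coordField p j) (coordField p k) p

lemma IsWeylConnection.curvature_eq_curvatureTensor (h : IsWeylConnection g nab φ)
    (hX : SmoothField X p) (hY : SmoothField Y p) (hZ : SmoothField Z p) :
    curvature nab X Y Z p = curvatureTensor nab p (X p) (Y p) (Z p) := by
  have hc (i : Fin n) := smoothField_coordField_self p i
  rw [curvatureTensor, (h.curvature_tensorial_left Y hZ).eq_sum hX]
  refine Finset.sum_congr rfl fun i _ => ?_
  rw [(h.curvature_tensorial_middle _ hZ).eq_sum hY]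
  congr 1
  refine Finset.sum_congr rfl fun j _ => ?_
  rw [(h.curvature_tensorial_right (hc i) (hc j)).eq_sum hZ]

lemma isLinearMap_curvatureTensor_left (y z : TangentSpace (𝓡 n) p) :
    IsLinearMap ℝ fun x => curvatureTensor nab p x y z where
  map_add x x' := by simp [curvatureTensor, add_smul, Finset.sum_add_distrib]
  map_smul c x := by simp [curvatureTensor, mul_smul, Finset.smul_sum]

lemma isLinearMap_curvatureTensor_middle (x z : TangentSpace (𝓡 n) p) :
    IsLinearMap ℝ fun y => curvatureTensor nab p x y z where
  map_add y y' := by simp [curvatureTensor, add_smul, Finset.sum_add_distrib]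
  map_smul c y := by
    simp only [curvatureTensor, map_smul, Finsupp.smul_apply, smul_eq_mul, Finset.smul_sum,
      smul_smul]
    simp only [mul_assoc, mul_left_comm c]

lemma isLinearMap_curvatureTensor_right (x y : TangentSpace (𝓡 n) p) :
    IsLinearMap ℝ fun z => curvatureTensor nab p x y z where
  map_add z z' := by simp [curvatureTensor, add_smul, Finset.sum_add_distrib]
  map_smul c z := by
    simp only [curvatureTensor, map_smul, Finsupp.smul_apply, smul_eq_mul, Finset.smul_sum,
      smul_smul]
    simp only [mul_left_comm c]

/-- The scalar curvature as a double contraction, with respect to an arbitrary basis. -/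
lemma IsWeylConnection.scalarCurvature_eq_contraction (h : IsWeylConnection g nab φ) (p : M)
    (b : Module.Basis (Fin n) ℝ (TangentSpace (𝓡 n) p)) :
    scalarCurvature g nab p = contraction g b fun y z => contraction g b fun x w =>
      g.inner p (curvatureTensor nab p x y z) w := by
  have hc (i : Fin n) := smoothField_coordField_self p i
  have h1 (y z : TangentSpace (𝓡 n) p) : (contraction g (tangentBasis p) fun x w =>
      g.inner p (curvatureTensor nab p x y z) w) = contraction g b fun x w =>
      g.inner p (curvatureTensor nab p x y z) w := by
    refine contraction_basis_indep g _ _ (fun w => ?_) fun x => ?_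
    · have := isLinearMap_curvatureTensor_left (nab := nab) y z
      exact ⟨fun x x' => by simp [this.map_add], fun c x => by simp [this.map_smul]⟩
    · exact (g.inner p _).toLinearMap.isLinear
  rw [← contraction_basis_indep g (tangentBasis p) b]
  · simp only [← h1, ← sum_repr_eq_contraction]
    simp only [scalarCurvature, contraction, gram_self_eq_basisGram, ricci,
      h.curvature_eq_curvatureTensor (hc _) (hc _) (hc _), coordField_self, coordForm_eq_repr]
  · intro z
    have (x : TangentSpace (𝓡 n) p) := isLinearMap_curvatureTensor_middle (nab := nab) x z
    exact ⟨fun y y' => by simp [contraction, (this _).map_add, mul_add, Finset.sum_add_distrib],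
      fun c y => by simp [contraction, (this _).map_smul, Finset.mul_sum, mul_left_comm]⟩
  · intro y
    have (x : TangentSpace (𝓡 n) p) := isLinearMap_curvatureTensor_right (nab := nab) x y
    exact ⟨fun y y' => by simp [contraction, (this _).map_add, mul_add, Finset.sum_add_distrib],
      fun c y => by simp [contraction, (this _).map_smul, Finset.mul_sum, mul_left_comm]⟩

/-- The scalar curvature is smooth. It is defined at each point by the chart at that point, so that
its smoothness near `p` relies on tensoriality, which allows to compute it in the chart at `p`. -/
lemma IsWeylConnection.smoothFun_scalarCurvature (h : IsWeylConnection g nab φ) (p : M) :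
    SmoothFun n (scalarCurvature g nab) p := by
  have hs (i j k : Fin n) {q : M} (hq : q ∈ (chartAt (Model n) p).source) :
      SmoothField (curvature nab (coordField p i) (coordField p j) (coordField p k)) q := by
    have hc (i : Fin n) := smoothField_coordField i hq
    exact ((SmoothField.weylConnection h (hc i) (.weylConnection h (hc j) (hc k))).sub
      (SmoothField.weylConnection h (hc j) (.weylConnection h (hc i) (hc k)))).sub
      (SmoothField.weylConnection h ((hc i).bracket (hc j)) (hc k))
  filter_upwards [eventually_mem_source (n := n) p] with q hq
  have hf : CInfFun n (fun q' ↦ ∑ i, ∑ j, (gram g p q')⁻¹ i j * ∑ k, ∑ l, (gram g p q')⁻¹ k l *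
      g.inner q' (curvature nab (coordField p k) (coordField p i) (coordField p j) q')
        (coordField p l q')) q := by
    refine ContMDiffAt.sum fun i _ => ContMDiffAt.sum fun j _ => ContMDiffAt.mul ?_ <|
      ContMDiffAt.sum fun k _ => ContMDiffAt.sum fun l _ => ContMDiffAt.mul ?_ ?_
    · exact CInfFun.gram_inv g hq i j
    · exact CInfFun.gram_inv g hq k l
    · exact (hs k i j hq).at.inner g (cInfField_coordField l hq)
  refine hf.congr_of_eventuallyEq ?_
  filter_upwards [(chartAt (Model n) p).open_source.mem_nhds hq] with q' hq'
  have hc (i : Fin n) := smoothField_coordField i hq'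
  rw [h.scalarCurvature_eq_contraction q' (frameAt p q' hq')]
  simp only [contraction, ← gram_eq_basisGram, frameAt_apply,
    h.curvature_eq_curvatureTensor (hc _) (hc _) (hc _)]

end

end

section

variable {n : ℕ} {M : Type*} [TopologicalSpace M] [ChartedSpace (Model n) M]

/-! ### The Laplacian as a divergence -/

lemma det_updateRow_eq_sum (A : Matrix (Fin n) (Fin n) ℝ) (i : Fin n) (h : Fin n → ℝ) :
    (A.updateRow i h).det = ∑ j, h j * A.adjugate j i := by
  rw [Matrix.det_eq_sum_mul_adjugate_row _ i]
  simp [Matrix.adjugate_apply]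

/-- The determinant as a continuous multilinear map of the rows. -/
def detMultilinear (n : ℕ) : ContinuousMultilinearMap ℝ (fun _ : Fin n => Fin n → ℝ) ℝ where
  toMultilinearMap := (Matrix.detRowAlternating (n := Fin n) (R := ℝ)).toMultilinearMap
  cont := Continuous.matrix_det (A := fun A : Fin n → Fin n → ℝ => A) continuous_id

/-- Jacobi's formula for the derivative of a determinant. -/
lemma mvfderiv_det {A : M → Matrix (Fin n) (Fin n) ℝ} {p : M}
    (hA : ∀ i j, CInfFun n (fun q ↦ A q i j) p) (h0 : (A p).det ≠ 0) (v : TangentSpace (𝓡 n) p) :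
    mvfderiv (𝓡 n) (fun q ↦ (A q).det) p v =
      (A p).det * ∑ i, ∑ j, (A p)⁻¹ j i * mvfderiv (𝓡 n) (fun q ↦ A q i j) p v := by
  have hd : MDifferentiableAt (𝓡 n) 𝓘(ℝ, Fin n → Fin n → ℝ) (fun q i j ↦ A q i j) p := by
    have : ContMDiffAt (𝓡 n) 𝓘(ℝ, Fin n → Fin n → ℝ) ∞ (fun q i j ↦ A q i j) p :=
      contMDiffAt_pi_space.2 fun i => contMDiffAt_pi_space.2 fun j => hA i j
    exact this.mdifferentiableAt (by simp)
  have h1 := mvfderiv_comp_normedSpace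
    ((detMultilinear n).hasFDerivAt (fun i j ↦ A p i j)) hd v
  have h2 (i j : Fin n) : mvfderiv (𝓡 n) (fun q ↦ A q i j) p v =
      mvfderiv (𝓡 n) (fun q (i j : Fin n) ↦ A q i j) p v i j := by
    let L : (Fin n → Fin n → ℝ) →L[ℝ] ℝ :=
      (ContinuousLinearMap.proj (R := ℝ) (φ := fun _ : Fin n => ℝ) j).comp
        (ContinuousLinearMap.proj (R := ℝ) (φ := fun _ : Fin n => Fin n → ℝ) i)
    exact mvfderiv_comp_normedSpace (F := L) L.hasFDerivAt hd v
  refine h1.trans ?_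
  rw [ContinuousMultilinearMap.linearDeriv_apply, Finset.mul_sum]
  refine Finset.sum_congr rfl fun i _ => ?_
  refine (det_updateRow_eq_sum (A p) i _).trans ?_
  rw [Finset.mul_sum]
  refine Finset.sum_congr rfl fun j _ => ?_
  rw [← h2, Matrix.inv_def, Ring.inverse_eq_inv', Matrix.smul_apply, smul_eq_mul]
  field_simp

variable [IsManifold (𝓡 n) ∞ M]

open VectorField

/-- The coordinate fields commute. -/
lemma mlieBracket_coordField (p : M) (i j : Fin n) :
    mlieBracket (𝓡 n) (coordField p i) (coordField p j) p = 0 := by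
  have h (i : Fin n) : (mpullbackWithin 𝓘(ℝ, Model n) (𝓡 n) (extChartAt (𝓡 n) p).symm
      (coordField p i) (Set.range (𝓡 n))) =ᶠ[𝓝 (extChartAt (𝓡 n) p p)]
      fun _ => (EuclideanSpace.single i 1 : Model n) := by
    filter_upwards [extChartAt_target_mem_nhds (I := 𝓡 n) p] with y hy
    have hy' : (extChartAt (𝓡 n) p).symm y ∈ (chartAt (Model n) p).source := by
      have := (extChartAt (𝓡 n) p).map_target hy
      rwa [extChartAt_source] at this
    rw [mpullbackWithin_apply, coordField_eq _ _ _ hy', (extChartAt (𝓡 n) p).right_inv hy]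
    have hinv := isInvertible_mfderivWithin_extChartAt_symm hy
    have hr : Set.range (𝓡 n) = Set.univ := by simp
    rw [hr, mfderivWithin_univ] at hinv ⊢
    exact hinv.inverse_apply_self _
  rw [← mlieBracketWithin_univ, mlieBracketWithin_apply]
  have hr : (extChartAt (𝓡 n) p).symm ⁻¹' Set.univ ∩ Set.range (𝓡 n) = Set.univ := by simp
  have key : lieBracketWithin ℝ
      (mpullbackWithin 𝓘(ℝ, Model n) (𝓡 n) (extChartAt (𝓡 n) p).symm
        (coordField p i) (Set.range (𝓡 n)) : Model n → Model n)
      (mpullbackWithin 𝓘(ℝ, Model n) (𝓡 n) (extChartAt (𝓡 n) p).symm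
        (coordField p j) (Set.range (𝓡 n)) : Model n → Model n) Set.univ
      (extChartAt (𝓡 n) p p) = 0 := by
    refine (congrFun (lieBracketWithin_univ (𝕜 := ℝ) (E := Model n)) _).trans ?_
    refine (Filter.EventuallyEq.lieBracket_vectorField_eq (h i) (h j)).trans ?_
    simp [lieBracket]
  rw [hr]
  exact (congrArg _ key).trans (map_zero _)

section

variable {g : Metric n M}
  {nab : VField n M → Π p : M, TangentSpace (𝓡 n) p →L[ℝ] TangentSpace (𝓡 n) p}
  {φ : OneForm n M} {p : M}

lemma IsWeylConnection.nab_sum (h : IsWeylConnection g nab φ) {ι : Type*} (s : Finset ι)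
    {X : ι → VField n M} (hX : ∀ i, SmoothField (X i) p) :
    nab (fun q ↦ ∑ i ∈ s, X i q) p = ∑ i ∈ s, nab (X i) p := by
  classical
  induction s using Finset.induction_on with
  | empty =>
    simp only [Finset.sum_empty]
    exact h.cov.zero
  | insert a s ha ih =>
    simp only [Finset.sum_insert ha, ← ih]
    exact h.cov.add (hX a).diff (SmoothField.sum fun i _ => hX i).diff

/-- `Γ^k_{ki} = (1/2) g^{kl} ∂_i g_{kl}` for the Christoffel symbols. -/
lemma trace_leviCivita_coordField (g : Metric n M) (p : M) (i : Fin n) :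
    ∑ k, (tangentBasis p).repr (leviCivita g (coordField p i) p (tangentBasis p k)) k =
      (1 / 2) * ∑ k, ∑ l, (gram g p p)⁻¹ l k *
        mvfderiv (𝓡 n) (fun q ↦ gram g p q k l) p (tangentBasis p i) := by
  have hc (i : Fin n) := (smoothField_coordField_self p i).diff
  have h1 (k : Fin n) : leviCivita g (coordField p i) p (tangentBasis p k) =
      leviCivita g (coordField p k) p (tangentBasis p i) := by
    have := leviCivita_torsion_free g (hc k) (hc i)
    rw [mlieBracket_coordField, sub_eq_zero] at this
    simpa only [coordField_self] using this
  set D : Fin n → TangentSpace (𝓡 n) p :=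
    fun k => leviCivita g (coordField p k) p (tangentBasis p i) with hD
  have h2 (k l : Fin n) : mvfderiv (𝓡 n) (fun q ↦ gram g p q k l) p (tangentBasis p i) =
      g.inner p (D k) (tangentBasis p l) + g.inner p (tangentBasis p k) (D l) := by
    have := leviCivita_metric g (hc k) (hc l) (tangentBasis p i)
    simp only [coordField_self] at this
    exact this
  simp only [h1, h2, repr_eq_sum_inv_basisGram g (tangentBasis p), gram_self_eq_basisGram, mul_add,
    Finset.sum_add_distrib]
  -- both halves of `∂_i g_{kl} = g(D_k, ∂_l) + g(∂_k, D_l)` contribute the same trace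
  have e1 : ∑ k, ∑ l, (basisGram g (tangentBasis p))⁻¹ l k *
      g.inner p (D k) (tangentBasis p l) = ∑ k, ∑ l, (basisGram g (tangentBasis p))⁻¹ k l *
      g.inner p (tangentBasis p l) (D k) := by
    refine Finset.sum_congr rfl fun k _ => Finset.sum_congr rfl fun l _ => ?_
    rw [basisGram_inv_symm, g.symm]
  have e2 : ∑ k, ∑ l, (basisGram g (tangentBasis p))⁻¹ l k *
      g.inner p (tangentBasis p k) (D l) = ∑ k, ∑ l, (basisGram g (tangentBasis p))⁻¹ k l *
      g.inner p (tangentBasis p l) (D k) := Finset.sum_comm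
  rw [e1, e2]
  simp only [hD]
  ring

/-- `Δ_g f = div (grad f)`: with `grad f = a^i ∂_i`, both sides are `∂_i a^i + a^i Γ^k_{ki}`, by
Jacobi's formula for the derivative of `det (g_{ij})`. -/
theorem divergence_grad (g : Metric n M) {f : M → ℝ} {p : M} (hf : SmoothFun n f p) :
    divergence g (grad g f) p = laplacian g f p := by
  have hc (i : Fin n) := smoothField_coordField_self p i
  have hL := isWeylConnection_leviCivita g
  set b := tangentBasis (n := n) p with hb
  let a (i : Fin n) (q : M) : ℝ :=
    ∑ j, (gram g p q)⁻¹ i j * mvfderiv (𝓡 n) f q (coordField p j q)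
  have ha (i : Fin n) : SmoothFun n (a i) p := by
    filter_upwards [eventually_mem_source (n := n) p, hf] with q hq hf
    exact ContMDiffAt.sum fun j _ => (CInfFun.gram_inv g hq i j).mul
      (hf.mvfderiv (cInfField_coordField j hq))
  have hs (i : Fin n) := SmoothField.smul (ha i) (hc i)
  have hgrad : ∀ᶠ q in 𝓝 p, grad g f q = ∑ i, (a i • coordField p i) q := by
    filter_upwards [eventually_mem_source (n := n) p] with q hq
    refine (eq_sum_gram_inv g hq (grad g f q)).trans (Finset.sum_congr rfl fun i _ => ?_)
    rw [← Finset.sum_smul]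
    simp only [Pi.smul_apply', a, grad, g.symm q (coordField p _ q), inner_sharp]
  have hS := SmoothField.sum (s := Finset.univ) fun i _ => hs i
  have e (v : TangentSpace (𝓡 n) p) : leviCivita g (grad g f) p v =
      ∑ i, (a i p • leviCivita g (coordField p i) p v + mvfderiv (𝓡 n) (a i) p v • b i) := by
    rw [hL.cov.congr_of_eventuallyEq (hS.congr hgrad).diff hS.diff Filter.univ_mem hgrad,
      hL.nab_sum _ hs, sum_apply]
    refine Finset.sum_congr rfl fun i _ => ?_
    rw [hL.cov.leibniz (hc i).diff (ha i).diff]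
    simp only [add_apply, smul_apply, ContinuousLinearMap.smulRight_apply, coordField_self, ← hb]
  have hdet := (gram_posDef g (mem_chart_source (Model n) p)).det_pos
  have hdetC : CInfFun n (fun q ↦ (gram g p q).det) p :=
    CInfFun.det fun i j => CInfFun.gram g (mem_chart_source _ p) i j
  have hsqrt := Real.sqrt_pos.2 hdet
  have hsq : DiffFun n (fun q ↦ √(gram g p q).det) p :=
    ((Real.hasDerivAt_sqrt hdet.ne').differentiableAt.mdifferentiableAt).comp p hdetC.diff
  have hlap (i : Fin n) : mvfderiv (𝓡 n) (fun q ↦ √(gram g p q).det * a i q) p (b i) =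
      √(gram g p p).det * (mvfderiv (𝓡 n) (a i) p (b i)
        + a i p * ∑ k, b.repr (leviCivita g (coordField p i) p (b k)) k) := by
    rw [mvfderiv_fun_mul hsq (ha i).diff, trace_leviCivita_coordField]
    simp only [add_apply, smul_apply, smul_eq_mul]
    rw [mvfderiv_comp_real (f := fun q ↦ (gram g p q).det) (Real.hasDerivAt_sqrt hdet.ne') hdetC.diff,
      mvfderiv_det (fun i j => CInfFun.gram g (mem_chart_source _ p) i j) hdet.ne']
    have := Real.mul_self_sqrt hdet.le
    generalize (∑ k, ∑ l, (gram g p p)⁻¹ l k *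
        mvfderiv (𝓡 n) (fun q ↦ gram g p q k l) p (b i)) = c
    field_simp
    linear_combination (-(a i p * c)) * this
  have hlap' : laplacian g f p = ∑ i, (mvfderiv (𝓡 n) (a i) p (b i)
      + a i p * ∑ k, b.repr (leviCivita g (coordField p i) p (b k)) k) := by
    have : laplacian g f p = (√(gram g p p).det)⁻¹ * ∑ i, mvfderiv (𝓡 n)
      (fun q ↦ √(gram g p q).det * a i q) p (b i) := rfl
    simp only [this, hlap, ← Finset.mul_sum]
    rw [inv_mul_cancel_left₀ hsqrt.ne']
  rw [hlap', divergence, ← sum_repr_eq_trace b]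
  simp only [e, map_sum, map_add, map_smul, Finsupp.coe_finsetSum, Finset.sum_apply,
    Finsupp.add_apply, Finsupp.smul_apply, smul_eq_mul, Finset.sum_add_distrib]
  rw [Finset.sum_comm, add_comm]
  congr 1
  · rw [Finset.sum_comm]
    refine Finset.sum_congr rfl fun i _ => ?_
    simp [Finsupp.single_apply]
  · simp only [Finset.mul_sum]

/-- `div (s X) = s div X + ds(X)`. -/
lemma divergence_smul (g : Metric n M) {s : M → ℝ} {X : VField n M} {p : M} (hs : SmoothFun n s p)
    (hX : SmoothField X p) :
    divergence g (s • X) p = s p * divergence g X p + mvfderiv (𝓡 n) s p (X p) := by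
  simp only [divergence, (isWeylConnection_leviCivita g).cov.leibniz hX.diff hs.diff,
    ← sum_repr_eq_trace (tangentBasis p), add_apply, smul_apply, map_add, map_smul,
    Finsupp.add_apply, Finsupp.smul_apply, smul_eq_mul, Finset.sum_add_distrib, Finset.mul_sum,
    ContinuousLinearMap.smulRight_apply, sum_repr_smul_const]

end

end

section

variable {n : ℕ} {M : Type*} [TopologicalSpace M] [ChartedSpace (Model n) M]
  [IsManifold (𝓡 n) ∞ M]

/-! ### Conformal change of the metric -/

set_option synthInstance.maxHeartbeats 200000 in
/-- The metric `s g` for a positive smooth function `s`. -/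
def conformalMetric (g : Metric n M) (s : M → ℝ) (hs : ∀ p, SmoothFun n s p) (h0 : ∀ p, 0 < s p) :
    Metric n M where
  inner p := s p • g.inner p
  symm p v w := by simp [g.symm p v w]
  pos p v hv := by simpa using mul_pos (h0 p) (g.pos p v hv)
  isVonNBounded p := by
    -- the unit ball of `s g` is the image of that of `g` under the homothety of ratio `1 / √s`
    refine ((g.isVonNBounded p).image
      ((√(s p))⁻¹ • ContinuousLinearMap.id ℝ (TangentSpace (𝓡 n) p))).subset fun v hv => ?_
    have hr := Real.sqrt_pos.2 (h0 p)
    refine ⟨√(s p) • v, ?_, by simp [smul_smul, hr.ne']⟩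
    simp only [Set.mem_ofPred_eq, smul_apply, smul_eq_mul, map_smul] at hv ⊢
    rwa [← mul_assoc, Real.mul_self_sqrt (h0 p).le]
  contMDiff := ContMDiff.smul_section
    (V := fun p : M ↦ TangentSpace (𝓡 n) p →L[ℝ] TangentSpace (𝓡 n) p →L[ℝ] ℝ) (fun p => (hs p).at) g.contMDiff

section

variable {g g' : Metric n M} {p : M}

/-- Only the trace depends on the metric: the Ricci tensor of a fixed connection does not. -/
lemma scalarCurvature_conformal {c : ℝ} (hg : g'.inner p = c • g.inner p)
    (nab : VField n M → Π p : M, TangentSpace (𝓡 n) p →L[ℝ] TangentSpace (𝓡 n) p) :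
    scalarCurvature g' nab p = c⁻¹ * scalarCurvature g nab p := by
  have h : gram g' p p = c • gram g p p := by
    ext i j
    simp [gram, hg]
  have hinv : (gram g' p p)⁻¹ = c⁻¹ • (gram g p p)⁻¹ := by
    rcases eq_or_ne c 0 with rfl | hc
    · simp [h]
    · exact h ▸ Matrix.inv_smul' _ (Units.mk0 c hc)
        (gram_posDef g (mem_chart_source _ p)).det_pos.ne'.isUnit
  simp only [scalarCurvature, hinv, Matrix.smul_apply, smul_eq_mul, Finset.mul_sum, mul_assoc]

lemma mul_kappa (hn : 3 ≤ n) (g : Metric n M) (p : M) :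
    n * (n - 1) * kappa g p = scalarCurvature g (leviCivita g) p := by
  have h : (3 : ℝ) ≤ n := by exact_mod_cast hn
  have h1 : (n : ℝ) * (n - 1) ≠ 0 := mul_ne_zero (by linarith) (by linarith)
  rw [kappa, ← mul_assoc, mul_one_div_cancel h1, one_mul]

/-- Conformal change of the scalar curvature: the Levi-Civita connection of `s g` is a Weyl
connection for `g`, with 1-form `(1/2) d ln s`. -/
theorem scalarCurvature_leviCivita_conformal {s : M → ℝ} (hs : ∀ p, SmoothFun n s p)
    (h0 : ∀ p, 0 < s p) (hg : ∀ p, g'.inner p = s p • g.inner p) (p : M) :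
    s p * scalarCurvature g' (leviCivita g') p = scalarCurvature g (leviCivita g) p
      - (n - 1) * (s p)⁻¹ * laplacian g s p
      - (n - 1) * (n - 6) / 4 * (s p ^ 2)⁻¹ * g.inner p (grad g s p) (grad g s p) := by
  let ψ : OneForm n M := fun q ↦ (1 / 2 * (s q)⁻¹) • mvfderiv (𝓡 n) s q
  have hinv (q : M) : SmoothFun n (fun q ↦ (s q)⁻¹) q :=
    (hs q).mono fun q' h => CInfFun.inv h (h0 q').ne'
  have hψ : IsWeylConnection g (leviCivita g') ψ := by
    refine (isWeylConnection_leviCivita g').conformal hinv (fun q => inv_pos.2 (h0 q))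
      (fun q => ?_) (fun q => ?_)
    · rw [hg, smul_smul, inv_mul_cancel₀ (h0 q).ne', one_smul]
    · ext v
      have e : (fun q ↦ Real.log (s q)⁻¹) = fun q ↦ -Real.log (s q) := by
        ext q; exact Real.log_inv _
      have hd := (Real.hasDerivAt_log (h0 q).ne').neg
      rw [e]
      simp only [ψ, sub_apply, smul_apply, zero_apply, smul_eq_mul,
        mvfderiv_comp_real (F := fun x ↦ -Real.log x) hd (hs q).diff]
      ring
  have hsharp : sharp g ψ = (fun q ↦ 1 / 2 * (s q)⁻¹) • grad g s := by
    ext1 q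
    refine metric_ext g fun w => ?_
    simp only [inner_sharp, Pi.smul_apply', map_smul, smul_apply, grad, ψ]
  have hgrad : SmoothField (grad g s) p := SmoothField.of_inner g fun Y hY => by
    simpa only [grad, inner_sharp] using (hs p).mvfderiv hY
  have hc : SmoothFun n (fun q ↦ 1 / 2 * (s q)⁻¹) p :=
    (hinv p).mono fun q h => contMDiffAt_const.mul h
  have hd := (hasDerivAt_inv (h0 p).ne').const_mul (1 / 2 : ℝ)
  have key := hψ.scalarCurvature_eq p
  have hnorm : mvfderiv (𝓡 n) s p (grad g s p) = g.inner p (grad g s p) (grad g s p) :=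
    (inner_sharp g (mvfderiv (𝓡 n) s) p _).symm
  rw [scalarCurvature_conformal (hg p), ← mul_assoc, mul_inv_cancel₀ (h0 p).ne', one_mul, key,
    normSq, hsharp, divergence_smul g hc hgrad, divergence_grad g (hs p),
    mvfderiv_comp_real (F := fun x ↦ 1 / 2 * x⁻¹) hd (hs p).diff, hnorm]
  simp only [Pi.smul_apply', map_smul, smul_apply, smul_eq_mul]
  have := (h0 p).ne'
  field_simp
  ring

end

end

end WeylGeometry

end

open WeylGeometry in
theorem proposition3p8 (n : ℕ) (hn : 3 ≤ n)
    {M : Type*} [TopologicalSpace M] [ChartedSpace (EuclideanSpace ℝ (Fin n)) M]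
    [IsManifold (𝓡 n) ∞ M]
    (g : Metric n M) (nab : CovariantDerivative (𝓡 n) (EuclideanSpace ℝ (Fin n)) (TangentSpace (𝓡 n) : M → Type))
    (φ : OneForm n M) (hW : IsWeyl g nab φ)
    (τ : M → ℝ) (hτ : τ = scalarCurvature g nab) (hpos : ∀ p, 0 < τ p)
    (φt : OneForm n M)
    (hφt : ∀ p, φt p = φ p - (1 / 2 : ℝ) • mvfderiv (𝓡 n) (fun q ↦ Real.log (τ q)) p) :
    ∃ gt : Metric n M, (∀ p, gt.inner p = τ p • g.inner p) ∧
      (∀ p, n * kappa gt p = n * (τ p)⁻¹ * kappa g p - (τ p ^ 2)⁻¹ * laplacian g τ p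
        - 1 / 4 * (τ p ^ 3)⁻¹ * ((n : ℝ) - 6) * g.inner p (grad g τ p) (grad g τ p)) ∧
      (∀ p, 1 = scalarCurvature gt nab p ∧
        scalarCurvature gt nab p = n * (n - 1) * kappa gt p
          - 2 * (n - 1) * divergence gt (sharp gt φt) p
          - (n - 1) * (n - 2) * normSq gt φt p) := by
  have hs (p : M) : SmoothFun n τ p := hτ ▸ hW.isWeylConnection.smoothFun_scalarCurvature p
  have hg (p : M) : (conformalMetric g τ hs hpos).inner p = τ p • g.inner p := rfl
  refine ⟨conformalMetric g τ hs hpos, hg, fun p => ?_, fun p => ⟨?_, ?_⟩⟩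
  · -- `h` is the claim multiplied by `(n - 1) τ`
    have h := scalarCurvature_leviCivita_conformal hs hpos hg p
    rw [← mul_kappa hn, ← mul_kappa hn] at h
    have hn' : (3 : ℝ) ≤ n := by exact_mod_cast hn
    have hn1 : (n : ℝ) - 1 ≠ 0 := by linarith
    have hτ0 := (hpos p).ne'
    refine mul_left_cancel₀ (mul_ne_zero hn1 hτ0) ?_
    linear_combination (norm := skip) h
    field_simp
    ring
  · rw [scalarCurvature_conformal (hg p), ← hτ, inv_mul_cancel₀ (hpos p).ne']
  · rw [mul_kappa hn]
    exact (hW.isWeylConnection.conformal hs hpos hg hφt).scalarCurvature_eq p
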